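/- Let $X$ be the Cantor space and let $\mathrm{Homeo}(X)$ be its group of homeomorphisms. For a compact metrizable zero-dimensional space $Y$, a subgroup $G\le \mathrm{Homeo}(Y)$ is called \emph{full} if it contains every $g\in\mathrm{Homeo}(Y)$ for which there are a finite partition $Y=\bigsqcup_{i=1}^n U_i$ into clopen sets and $\gamma_1,\dots,\gamma_n\in G$ with $g(x)=\gamma_i(x)$ for all $i$ and all $x\in U_i$. An \emph{ample group} over $X$ is a countable, locally finite, full subgroup $\Gamma\le\mathrm{Homeo}(X)$ such that $\{x\in X:\gamma(x)=x\}$ is clopen for every $\gamma\in\Gamma$; it is \emph{minimal} if all its orbits are dense. For clopen $A,B\subseteq X$ write $A\sim_\Gamma B$ if $\gamma(A)=B$ for some $\gamma\in\Gamma$. Two ample groups $\Gamma,\Lambda$ \emph{induce isomorphic relations on $\mathrm{Clopen}(X)$} if there is $\varphi\in\mathrm{Homeo}(X)$ such that, for all clopen $A,B$, $A\sim_\Gamma B$ if and only if $\varphi(A)\sim_\Lambda\varphi(B)$. A closed set $K\subseteq X$ is \emph{$\Gamma$-malleable} if it is $\Gamma$-thin, i.e. $\mu(K)=0$ for every $\Gamma$-invariant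 Borel probability measure $\mu$ on $X$, and $\Gamma$-étale, i.e. for every $\gamma\in\Gamma$ and every clopen subset $A$ of $K$ the set $\gamma(A)\cap K$ is clopen in $K$. In that case, for each $\gamma\in\Gamma$ with $\gamma^2=\mathrm{id}$, the map $\gamma_K\colon K\to K$ given by $\gamma_K(x)=\gamma(x)$ if $\gamma(x)\in K$ and $\gamma_K(x)=x$ otherwise is a homeomorphism of $K$; let $\Gamma_K$ be the smallest full subgroup of $\mathrm{Homeo}(K)$ that contains all these $\gamma_K$. \textbf{Theorem.} Let $\Gamma$ and $\Lambda$ be minimal ample groups over the Cantor space $X$ that induce isomorphic relations on $\mathrm{Clopen}(X)$. Let $K\subseteq X$ be $\Gamma$-malleable and $L\subseteq X$ be $\Lambda$-malleable. Then for every homeomorphism $h\colon K\to L$ such that $h\Gamma_K h^{-1}=\Lambda_L$ there is a homeomorphism $H\colon X\to X$ such that $H|_K=h$ and $H\Gamma H^{-1}=\Lambda$. -/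

import Mathlib

open Set MeasureTheory

noncomputable section

namespace CantorDynamics

variable {X Y : Type*} [TopologicalSpace X] [TopologicalSpace Y]

/-- The full group `F(Γ)` of `Γ ≤ Homeo(X)`: all homeomorphisms `g` for which there are a finite
clopen partition of `X` and elements of `Γ`, one for each piece, that agree with `g` on the
corresponding pieces. -/
def fullGroup (Γ : Subgroup (X ≃ₜ X)) : Set (X ≃ₜ X) :=
  {g | ∃ (n : ℕ) (U : Fin n → Set X) (γ : Fin n → (X ≃ₜ X)),
    (∀ i, IsClopen (U i)) ∧ Pairwise (fun i j => Disjoint (U i) (U j)) ∧ (⋃ i, U i) = univ ∧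
      ∀ i, γ i ∈ Γ ∧ ∀ x ∈ U i, g x = γ i x}

/-- `Γ` is a full group if `F(Γ) = Γ`. -/
def IsFull (Γ : Subgroup (X ≃ₜ X)) : Prop :=
  fullGroup Γ = (Γ : Set (X ≃ₜ X))

/-- An ample group over `X`: a countable, locally finite full group of homeomorphisms in which
the fixed-point set of every element is clopen. -/
structure IsAmple (Γ : Subgroup (X ≃ₜ X)) : Prop where
  countable : Countable Γ
  locallyFinite : ∀ H : Subgroup (X ≃ₜ X), H ≤ Γ → H.FG → Finite H
  full : IsFull Γ
  isClopen_fixed : ∀ γ ∈ Γ, IsClopen {x : X | γ x = x}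

/-- `Γ` acts minimally on `X`: every orbit is dense. -/
def IsMinimal (Γ : Subgroup (X ≃ₜ X)) : Prop :=
  ∀ x : X, Dense {y : X | ∃ γ ∈ Γ, γ x = y}

/-- The relation `A ∼_Γ B` on clopen sets: some element of `Γ` maps `A` onto `B`. -/
def EquiDec (Γ : Subgroup (X ≃ₜ X)) (A B : Set X) : Prop :=
  ∃ γ ∈ Γ, γ '' A = B

/-- `Γ` and `Λ` induce isomorphic relations on `Clopen(X)`. -/
def IsomorphicOnClopens (Γ Λ : Subgroup (X ≃ₜ X)) : Prop :=
  ∃ φ : X ≃ₜ X, ∀ A B : Set X, IsClopen A → IsClopen B →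
    (EquiDec Γ A B ↔ EquiDec Λ (φ '' A) (φ '' B))

/-- `K` is `Γ`-thin: it is null for every `Γ`-invariant Borel probability measure. -/
def IsThin [MeasurableSpace X] (Γ : Subgroup (X ≃ₜ X)) (K : Set X) : Prop :=
  ∀ μ : Measure X, IsProbabilityMeasure μ → (∀ γ ∈ Γ, μ.map γ = μ) → μ K = 0

/-- `K` is `Γ`-étale: for all `γ ∈ Γ` and all clopen subsets `A` of `K`, the set `γ A ∩ K` is
clopen in `K`. -/
def IsEtale (Γ : Subgroup (X ≃ₜ X)) (K : Set X) : Prop :=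
  ∀ γ ∈ Γ, ∀ A : Set K, IsClopen A → IsClopen {y : K | ∃ x ∈ A, γ (x : X) = (y : X)}

/-- `K` is `Γ`-malleable: it is closed, `Γ`-thin and `Γ`-étale. -/
structure IsMalleable [MeasurableSpace X] (Γ : Subgroup (X ≃ₜ X)) (K : Set X) : Prop where
  isClosed : IsClosed K
  thin : IsThin Γ K
  etale : IsEtale Γ K

open Classical in
/-- The map `γ_K : K → K` with `γ_K x = γ x` if `γ x ∈ K` and `γ_K x = x` otherwise. -/
def inducedMap (γ : X ≃ₜ X) (K : Set X) (x : K) : K :=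
  if h : γ x ∈ K then ⟨γ x, h⟩ else x

/-- `Γ_K`: the smallest full subgroup of `Homeo(K)` that contains `γ_K` for every involution
`γ ∈ Γ`. The three lemmas below verify that, for `K` a `Γ`-étale set, each `γ_K` is indeed a
homeomorphism of `K`, and that the infimum is itself full and contains all of them. -/
def inducedGroup (Γ : Subgroup (X ≃ₜ X)) (K : Set X) : Subgroup (K ≃ₜ K) :=
  sInf {H | IsFull H ∧
    ∀ γ ∈ Γ, γ * γ = 1 → ∀ g : K ≃ₜ K, (∀ x, g x = inducedMap γ K x) → g ∈ H}

theorem exists_homeomorph_inducedMap {Γ : Subgroup (X ≃ₜ X)} {K : Set X} (hK : IsEtale Γ K)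
    {γ : X ≃ₜ X} (hγ : γ ∈ Γ) (hinv : γ * γ = 1) :
    ∃ g : K ≃ₜ K, ∀ x, g x = inducedMap γ K x := by
  have hγγ : ∀ x, γ (γ x) = x := fun x => by
    rw [← Homeomorph.mul_apply, hinv, Homeomorph.one_apply]
  have hinvol : ∀ x : K, inducedMap γ K (inducedMap γ K x) = x := by
    intro x
    by_cases h : γ x ∈ K
    · simp [inducedMap, h, hγγ]
    · simp [inducedMap, h]
  have hcl : IsClopen {y : K | γ y ∈ K} := by
    convert hK γ hγ univ isClopen_univ using 1
    ext y
    constructor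
    · intro h
      exact ⟨⟨γ y, h⟩, mem_univ _, hγγ y⟩
    · rintro ⟨x, -, hx⟩
      change γ y ∈ K
      rw [← hx, hγγ]
      exact x.2
  have hcont : Continuous (inducedMap γ K) := by
    rw [Topology.IsInducing.subtypeVal.continuous_iff]
    classical
    have : (Subtype.val ∘ inducedMap γ K) =
        {y : K | γ y ∈ K}.piecewise (fun y : K => γ y) (fun y : K => (y : X)) := by
      funext y
      by_cases h : γ y ∈ K
      · simp [inducedMap, h, Set.piecewise]
      · simp [inducedMap, h, Set.piecewise]
    rw [this]
    refine continuous_piecewise ?_ (by fun_prop) (by fun_prop)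
    simp [hcl.frontier_eq]
  exact ⟨⟨⟨inducedMap γ K, inducedMap γ K, hinvol, hinvol⟩, hcont, hcont⟩, fun _ => rfl⟩

theorem isFull_inducedGroup (Γ : Subgroup (X ≃ₜ X)) (K : Set X) :
    IsFull (inducedGroup Γ K) := by
  apply Subset.antisymm
  · rintro g ⟨n, U, γ, hU, hd, hc, hg⟩
    refine Subgroup.mem_sInf.2 fun H hH => ?_
    change g ∈ (H : Set _)
    rw [← hH.1]
    exact ⟨n, U, γ, hU, hd, hc, fun i => ⟨Subgroup.mem_sInf.1 (hg i).1 H hH, (hg i).2⟩⟩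
  · intro g hg
    refine ⟨1, fun _ => univ, fun _ => g, fun _ => isClopen_univ, ?_, ?_, fun _ => ⟨hg, ?_⟩⟩
    · intro i j hij
      exact absurd (Subsingleton.elim i j) hij
    · exact iUnion_const _
    · exact fun _ _ => rfl

theorem mem_inducedGroup {Γ : Subgroup (X ≃ₜ X)} {K : Set X} {γ : X ≃ₜ X} (hγ : γ ∈ Γ)
    (hinv : γ * γ = 1) {g : K ≃ₜ K} (hg : ∀ x, g x = inducedMap γ K x) :
    g ∈ inducedGroup Γ K :=
  Subgroup.mem_sInf.2 fun _ hH => hH.2 γ hγ hinv g hg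

/-- The conjugate `h G h⁻¹ ⊆ Homeo(Y)` of `G ≤ Homeo(X)` by a homeomorphism `h : X → Y`. -/
def conjugate (h : X ≃ₜ Y) (G : Subgroup (X ≃ₜ X)) : Set (Y ≃ₜ Y) :=
  {f | ∃ g ∈ G, f = (h.symm.trans g).trans h}

end CantorDynamics

end

/-!
# Extending conjugacies from malleable sets

The homeomorphism `H` is obtained by a back-and-forth construction in the style of Krieger. A
finite approximation to `H` is a pair of *foldings* (`IsFolding`): a clopen partition of `X` into
cells together with an idempotent map that sends each cell onto a base cell by an element of the
group. The foldings, one along `Γ` and one along `Λ`, have the same combinatorics and respect both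
the given isomorphism `φ` of the relations on clopen sets and the given map `h` on `K`
(`IsMatching`). The folding maps remember the part of the group treated so far: a group element
under which the folding map is invariant is locally a composition of branches of the folding, and
so its conjugate by the limit homeomorphism lies in the other group (`IsFolding.conj_mem`).

A matching is enlarged by two moves on the base: a base cell is partitioned
(`IsMatching.exists_refine`), or a base cell is identified with its image, another base cell, under
an element `τ` of `Γ` (`IsMatching.exists_merge`). Together they absorb any given element of `Γ`
(`IsMatching.exists_step`): a finite group containing it permutes the cells of a fine enough
partition, and cells in the same orbit are merged one pair after another. In both moves the map `h`
descends along the foldings to a local conjugacy between the images of `K` and `L` in the bases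
(`IsMatching.descend`); this works because étaleness makes a folding, restricted to `K`, an open
map onto its image. Thus the moves only have to be made compatible with one local conjugacy between
two thin closed sets.

Here thinness enters. A thin closed set `F` embeds, locally in the group, into every nonempty
clopen set (`exists_embedding_of_isThin`): otherwise uniform measures on finite orbits would
accumulate at an invariant probability measure charging `F`. Exchanging neighbourhoods of `F` and
of its image by an involution in the full group (`IsFull.exists_swap`, `IsFull.exists_extension`),
one can move `F` to any prescribed place (`exists_mem_recolor`), and one can extend a map, locally
in the group, between closed subsets of thin sets to a group element that creates no further
coincidences between these thin sets (`exists_mem_extend`). With the first statement an arbitrary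
matching partition of a base cell is corrected so as to fit `h`, and with the second an arbitrary
group element matching `τ` is corrected so as to fit the action of `τ` on `K`.
-/

noncomputable section

open Filter Topology

namespace CantorDynamics

/-! ### Maps that are locally given by elements of a group -/

section LocallyIn

variable {X : Type*} [TopologicalSpace X] {Γ : Subgroup (X ≃ₜ X)}

/-- The map `s` agrees on `E`, locally in the relative topology of `E`, with elements of `Γ`. -/
def LocallyIn (Γ : Subgroup (X ≃ₜ X)) (s : X → X) (E : Set X) : Prop :=
  ∀ x ∈ E, ∃ γ ∈ Γ, ∀ᶠ y in 𝓝[E] x, s y = γ y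

theorem LocallyIn.continuousOn {s : X → X} {E : Set X} (hs : LocallyIn Γ s E) :
    ContinuousOn s E := by
  intro x hx
  obtain ⟨γ, -, h⟩ := hs x hx
  exact γ.continuous.continuousWithinAt.congr_of_eventuallyEq h (h.self_of_nhdsWithin hx)

theorem LocallyIn.mono {s : X → X} {E F : Set X} (hs : LocallyIn Γ s F) (h : E ⊆ F) :
    LocallyIn Γ s E := fun x hx =>
  let ⟨γ, hγ, e⟩ := hs x (h hx)
  ⟨γ, hγ, e.filter_mono (nhdsWithin_mono x h)⟩

theorem apply_mem_iff_of_fixes_compl {σ : X ≃ₜ X} {A O : Set X} (hOA : O ⊆ A)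
    (h : ∀ x ∉ O, σ x = x) (x : X) : σ x ∈ A ↔ x ∈ A := by
  constructor
  · intro hx
    by_contra hxA
    exact hxA (h x (fun h => hxA (hOA h)) ▸ hx)
  · intro hx
    by_contra hxA
    have h1 : σ (σ x) = σ x := h _ fun h => hxA (hOA h)
    exact hxA ((σ.injective h1).symm ▸ hx)

theorem exists_fin_range_eq [CompactSpace X] {D : Type*} {f : X → D} (hf : IsLocallyConstant f) :
    ∃ (n : ℕ) (d : Fin n → D), Function.Injective d ∧ range d = range f := by
  have := hf.range_finite.to_subtype
  obtain ⟨n, ⟨e⟩⟩ := Finite.exists_equiv_fin (range f)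
  refine ⟨n, fun i => (e.symm i : D), Subtype.val_injective.comp e.symm.injective, ?_⟩
  rw [range_comp' Subtype.val e.symm, e.symm.surjective.range_eq, image_univ, Subtype.range_coe]

variable [CompactSpace X] [T2Space X] [TotallyDisconnectedSpace X]

/-- A choice of `d` with `P y d` that can be made locally constantly on a compact set `E` extends
to a locally constant function on the whole space. -/
theorem exists_isLocallyConstant {D : Type*} [Nonempty D] {E : Set X} (hE : IsCompact E)
    {P : X → D → Prop} (h : ∀ x ∈ E, ∃ d, ∀ᶠ y in 𝓝[E] x, P y d) :
    ∃ f : X → D, IsLocallyConstant f ∧ ∀ y ∈ E, P y (f y) := by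
  classical
  suffices H : ∃ V : Set X, IsClopen V ∧ E ⊆ V ∧
      ∃ f : X → D, IsLocallyConstant f ∧ ∀ y ∈ E ∩ V, P y (f y) by
    obtain ⟨V, -, hEV, f, hf, h⟩ := H
    exact ⟨f, hf, fun y hy => h y ⟨hy, hEV hy⟩⟩
  refine hE.induction_on (p := fun T => ∃ V : Set X, IsClopen V ∧ T ⊆ V ∧
      ∃ f : X → D, IsLocallyConstant f ∧ ∀ y ∈ E ∩ V, P y (f y)) ?_ ?_ ?_ ?_
  · exact ⟨∅, isClopen_empty, Subset.rfl, fun _ => Classical.arbitrary D,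
      IsLocallyConstant.const _, by simp⟩
  · rintro s t hst ⟨V, hV, htV, h⟩
    exact ⟨V, hV, hst.trans htV, h⟩
  · rintro s t ⟨V, hV, hsV, f, hf, hfP⟩ ⟨W, hW, htW, g, hg, hgP⟩
    refine ⟨V ∪ W, hV.union hW, union_subset_union hsV htW, V.piecewise f g, ?_, ?_⟩
    · rw [IsLocallyConstant.iff_eventually_eq]
      intro x
      by_cases hx : x ∈ V
      · filter_upwards [hf.eventually_eq x, hV.isOpen.mem_nhds hx] with y hy hyV
        simp [hx, hyV, hy]
      · filter_upwards [hg.eventually_eq x, hV.compl.isOpen.mem_nhds hx] with y hy hyV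
        simp only [mem_compl_iff] at hyV
        simp [hx, hyV, hy]
    · rintro y ⟨hyE, hy⟩
      by_cases hyV : y ∈ V
      · simpa [hyV] using hfP y ⟨hyE, hyV⟩
      · simpa [hyV] using hgP y ⟨hyE, hy.resolve_left hyV⟩
  · intro x hx
    obtain ⟨d, hd⟩ := h x hx
    obtain ⟨O, hO, hxO, hOP⟩ := mem_nhdsWithin.1 hd
    obtain ⟨V, hV, hxV, hVO⟩ := compact_exists_isClopen_in_isOpen hO hxO
    exact ⟨V, mem_nhdsWithin_of_mem_nhds (hV.isOpen.mem_nhds hxV), V, hV, Subset.rfl,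
      fun _ => d, IsLocallyConstant.const _, fun y hy => hOP ⟨hVO hy.2, hy.1⟩⟩

/-- Membership in a full group is a local property. -/
theorem IsFull.mem_of_locallyIn (hΓ : IsFull Γ) {g : X ≃ₜ X}
    (hg : ∀ x, ∃ γ ∈ Γ, ∀ᶠ y in 𝓝 x, g y = γ y) : g ∈ Γ := by
  obtain ⟨f, hf, hP⟩ := exists_isLocallyConstant (E := univ) (D := X ≃ₜ X) isCompact_univ
    (P := fun y γ => γ ∈ Γ ∧ g y = γ y) (fun x _ => by
      obtain ⟨γ, hγ, h⟩ := hg x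
      exact ⟨γ, by simpa using ⟨hγ, h⟩⟩)
  obtain ⟨n, d, hd, hdf⟩ := exists_fin_range_eq hf
  have hmem : g ∈ fullGroup Γ := by
    refine ⟨n, fun i => f ⁻¹' {d i}, d, fun i => hf.isClopen_fiber _, ?_, ?_, ?_⟩
    · intro i j hij
      refine Disjoint.preimage f (disjoint_singleton.2 (hd.ne hij))
    · refine eq_univ_of_forall fun x => mem_iUnion.2 ?_
      have : f x ∈ range d := hdf ▸ mem_range_self x
      obtain ⟨i, hi⟩ := this
      exact ⟨i, hi.symm⟩
    · intro i
      have : d i ∈ range f := hdf ▸ mem_range_self i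
      obtain ⟨x, hx⟩ := this
      exact ⟨hx ▸ (hP x (mem_univ x)).1, fun y hy => by
        rw [← show f y = d i from hy]; exact (hP y (mem_univ y)).2⟩
  rw [hΓ] at hmem
  exact hmem

/-- An injective map, locally in `Γ`, of a clopen set `W` onto a set disjoint from `W` extends to
the involution in `Γ` that exchanges `W` with its image. -/
theorem IsFull.exists_swap (hΓ : IsFull Γ) {W : Set X} (hW : IsClopen W) {s : X → X}
    (hs : LocallyIn Γ s W) (hinj : InjOn s W) (hd : Disjoint W (s '' W)) :
    ∃ σ ∈ Γ, EqOn σ s W ∧ (∀ x ∉ W ∪ s '' W, σ x = x) ∧ σ * σ = 1 := by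
  classical
  rcases isEmpty_or_nonempty X with hX | hX
  · exact ⟨1, Γ.one_mem, fun x => hX.elim x, fun x => hX.elim x, one_mul 1⟩
  have ht1 : ∀ x ∈ W, Function.invFunOn s W (s x) = x := fun x hx => hinj.leftInvOn_invFunOn hx
  let f : X → X := fun x => if x ∈ W then s x else
    if x ∈ s '' W then Function.invFunOn s W x else x
  have hfW : ∀ x ∈ W, f x = s x := fun x hx => if_pos hx
  have hfs : ∀ x ∈ W, f (s x) = x := fun x hx => by
    have h1 : s x ∉ W := fun h => disjoint_left.1 hd h (mem_image_of_mem s hx)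
    simp only [f, if_neg h1, if_pos (mem_image_of_mem s hx), ht1 x hx]
  have hf0 : ∀ x ∉ W ∪ s '' W, f x = x := fun x hx => by
    rw [mem_union, not_or] at hx
    simp only [f, if_neg hx.1, if_neg hx.2]
  have hinv : Function.Involutive f := by
    intro x
    by_cases hx : x ∈ W ∪ s '' W
    · rcases hx with hx | ⟨y, hy, rfl⟩
      · rw [hfW x hx, hfs x hx]
      · rw [hfs y hy, hfW y hy]
    · rw [hf0 x hx, hf0 x hx]
  have hloc' : ∀ x ∈ W, ∃ γ ∈ Γ, s x = γ x ∧ ∀ᶠ y in 𝓝 x, y ∈ W ∧ s y = γ y := fun x hx => by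
    obtain ⟨γ, hγ, h⟩ := hs x hx
    rw [hW.isOpen.nhdsWithin_eq hx] at h
    exact ⟨γ, hγ, h.self_of_nhds, (hW.isOpen.eventually_mem hx).and h⟩
  have himg : ∀ x ∈ W, ∃ γ ∈ Γ, ∀ᶠ z in 𝓝 (s x), z ∈ s '' W ∧ f z = γ z := fun x hx => by
    obtain ⟨γ, hγ, hx', h⟩ := hloc' x hx
    refine ⟨γ⁻¹, Γ.inv_mem hγ, ?_⟩
    have ht : Tendsto γ.symm (𝓝 (s x)) (𝓝 x) := by
      have := γ.symm.continuous.tendsto (s x)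
      rwa [hx', γ.symm_apply_apply, ← hx'] at this
    filter_upwards [ht.eventually h] with z ⟨hz1, hz2⟩
    rw [γ.apply_symm_apply] at hz2
    refine ⟨⟨_, hz1, hz2⟩, ?_⟩
    rw [Homeomorph.inv_apply]
    conv_lhs => rw [← hz2]
    exact hfs _ hz1
  have hcl : IsClosed (s '' W) :=
    (hW.isClosed.isCompact.image_of_continuousOn hs.continuousOn).isClosed
  have hloc : ∀ x, ∃ γ ∈ Γ, ∀ᶠ y in 𝓝 x, f y = γ y := by
    intro x
    by_cases hx : x ∈ W ∪ s '' W
    · rcases hx with hx | ⟨y, hy, rfl⟩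
      · obtain ⟨γ, hγ, -, h⟩ := hloc' x hx
        exact ⟨γ, hγ, h.mono fun y hy => by rw [hfW y hy.1, hy.2]⟩
      · obtain ⟨γ, hγ, h⟩ := himg y hy
        exact ⟨γ, hγ, h.mono fun z hz => hz.2⟩
    · exact ⟨1, Γ.one_mem, mem_of_superset
        ((hW.isClosed.union hcl).isOpen_compl.mem_nhds hx) fun y hy => hf0 y hy⟩
  have hcont : Continuous f := continuous_iff_continuousAt.2 fun x => by
    obtain ⟨γ, -, h⟩ := hloc x
    exact γ.continuous.continuousAt.congr (h.mono fun y hy => hy.symm)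
  refine ⟨⟨⟨f, f, hinv, hinv⟩, hcont, hcont⟩, hΓ.mem_of_locallyIn hloc, hfW, hf0, ?_⟩
  ext x
  exact hinv x

/-- An injective map `s`, locally in `Γ`, of a compact set `E` onto a set disjoint from `E` extends
to an element of `Γ` supported in any given neighbourhood of `E` and its image. -/
theorem IsFull.exists_extension (hΓ : IsFull Γ) {E O : Set X} (hE : IsCompact E) {s : X → X}
    (hs : LocallyIn Γ s E) (hinj : InjOn s E) (hd : Disjoint E (s '' E)) (hO : IsOpen O)
    (hEO : E ⊆ O) (hsO : s '' E ⊆ O) :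
    ∃ σ ∈ Γ, EqOn σ s E ∧ ∀ x ∉ O, σ x = x := by
  -- extend `s` to a map `S` that is locally in `Γ` everywhere
  obtain ⟨l, hl, hP⟩ := exists_isLocallyConstant (D := X ≃ₜ X) hE
    (P := fun y γ => γ ∈ Γ ∧ s y = γ y) (fun x hx => by
      obtain ⟨γ, hγ, h⟩ := hs x hx
      exact ⟨γ, h.mono fun y hy => ⟨hγ, hy⟩⟩)
  let S : X → X := fun x => l x x
  have hSl : ∀ x, ∀ᶠ y in 𝓝 x, S y = l x y := fun x =>
    (hl.eventually_eq x).mono fun y hy => by simp only [S, hy]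
  have hScont : Continuous S := continuous_iff_continuousAt.2 fun x =>
    (l x).continuous.continuousAt.congr ((hSl x).mono fun y hy => hy.symm)
  have hSs : EqOn S s E := fun x hx => (hP x hx).2.symm
  have hSE : S '' E = s '' E := hSs.image_eq
  obtain ⟨t, ht, htinj⟩ := (hinj.congr hSs.symm).exists_mem_nhdsSet hE
    (fun x _ => hScont.continuousAt) (fun x _ => ⟨_, hSl x, fun y hy z hz h => by
      have hy' : S y = l x y := hy
      have hz' : S z = l x z := hz
      rw [hy', hz'] at h
      exact (l x).injective h⟩)
  obtain ⟨T, hT, hET, hTt⟩ := mem_nhdsSet_iff_exists.1 ht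
  obtain ⟨O₁, O₂, hO₁, hO₂, hEO₁, hEO₂, hO₁₂⟩ := SeparatedNhds.of_isCompact_isCompact hE
    (hE.image hScont) (hSE ▸ hd)
  have hΓO : IsOpen (l ⁻¹' {γ | γ ∈ Γ}) := hl _
  obtain ⟨W, hW, hEW, hWsub⟩ := exists_clopen_of_closed_subset_open hE.isClosed
    (U := T ∩ O ∩ O₁ ∩ S ⁻¹' (O ∩ O₂) ∩ l ⁻¹' {γ | γ ∈ Γ})
    ((((hT.inter hO).inter hO₁).inter ((hO.inter hO₂).preimage hScont)).inter hΓO)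
    (fun x hx => ⟨⟨⟨⟨hET hx, hEO hx⟩, hEO₁ hx⟩, hsO (hSE ▸ mem_image_of_mem S hx),
      hEO₂ (mem_image_of_mem S hx)⟩, (hP x hx).1⟩)
  obtain ⟨σ, hσ, h1, h2, -⟩ := hΓ.exists_swap hW (s := S)
    (fun x hx => ⟨l x, (hWsub hx).2, mem_nhdsWithin_of_mem_nhds (hSl x)⟩)
    (htinj.mono fun x hx => hTt (hWsub hx).1.1.1.1)
    (disjoint_left.2 fun x hx hx' => by
      obtain ⟨y, hy, rfl⟩ := hx'
      exact disjoint_left.1 hO₁₂ (hWsub hx).1.1.2 (hWsub hy).1.2.2)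
  refine ⟨σ, hσ, fun x hx => (h1 (hEW hx)).trans (hSs hx), fun x hx => h2 x ?_⟩
  rintro (h | ⟨y, hy, rfl⟩)
  · exact hx (hWsub h).1.1.1.2
  · exact hx (hWsub hy).1.2.1

end LocallyIn

/-! ### Comparison of clopen sets -/

section Comparison

variable {X : Type*} [TopologicalSpace X] {Γ : Subgroup (X ≃ₜ X)}

/-- The orbit of a point under a group of homeomorphisms. -/
def orbitSet (G : Subgroup (X ≃ₜ X)) (x : X) : Set X := {y | ∃ g ∈ G, g x = y}

theorem finite_orbitSet (G : Subgroup (X ≃ₜ X)) [Finite G] (x : X) : (orbitSet G x).Finite :=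
  (toFinite (G : Set (X ≃ₜ X))).image (fun g : X ≃ₜ X => g x)

/-- Greedy matching: going through the list `l`, every unmatched point `y` of `V` with `g y` an
unmatched point of `U` is matched with `g y`. In the end no element of `l` maps an unmatched point
of `V` to an unmatched point of `U`. -/
theorem exists_greedy_matching {U V : Set X} (hU : IsClopen U) (hV : IsClopen V)
    (l : List (X ≃ₜ X)) (hl : ∀ g ∈ l, g ∈ Γ) :
    ∃ (W : Set X) (s : X → X), IsClopen W ∧ W ⊆ V ∧ InjOn s W ∧ MapsTo s W U ∧
      LocallyIn Γ s W ∧ IsClopen (s '' W) ∧ (∀ y ∈ W, ∃ g ∈ l, s y = g y) ∧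
      ∀ y ∈ V \ W, ∀ g ∈ l, g y ∈ U → g y ∈ s '' W := by
  classical
  induction l with
  | nil =>
    exact ⟨∅, id, isClopen_empty, empty_subset _, injOn_empty _, mapsTo_empty _ _,
      fun x hx => hx.elim, by simpa using isClopen_empty, by simp, by simp⟩
  | cons g l ih =>
    obtain ⟨W, s, hW, hWV, hinj, hmaps, hloc, himg, hsl, hmax⟩ :=
      ih fun g hg => hl g (List.mem_cons_of_mem _ hg)
    have hg : g ∈ Γ := hl g List.mem_cons_self
    set N : Set X := (V \ W) ∩ g ⁻¹' (U \ s '' W) with hN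
    have hNcl : IsClopen N := (hV.diff hW).inter ((hU.diff himg).preimage g.continuous)
    have hsW : EqOn (W.piecewise s g) s W := piecewise_eqOn _ _ _
    have hsN : EqOn (W.piecewise s g) g N := fun x hx => piecewise_eq_of_notMem _ _ _ hx.1.2
    have himage : W.piecewise s g '' (W ∪ N) = s '' W ∪ g '' N := by
      rw [image_union, hsW.image_eq, hsN.image_eq]
    refine ⟨W ∪ N, W.piecewise s g, hW.union hNcl, union_subset hWV fun x hx => hx.1.1,
      ?_, ?_, ?_, ?_, ?_, ?_⟩
    · have hd : Disjoint W N := disjoint_left.2 fun x hx hx' => hx'.1.2 hx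
      refine (injOn_union hd).2 ⟨hinj.congr hsW.symm, g.injective.injOn.congr hsN.symm, ?_⟩
      intro a ha b hb hab
      rw [hsW ha, hsN hb] at hab
      exact hb.2.2 (hab ▸ mem_image_of_mem s ha)
    · rintro x (hx | hx)
      · rw [hsW hx]; exact hmaps hx
      · rw [hsN hx]; exact hx.2.1
    · rintro x (hx | hx)
      · obtain ⟨γ, hγ, h⟩ := hloc x hx
        rw [hW.isOpen.nhdsWithin_eq hx] at h
        refine ⟨γ, hγ, mem_nhdsWithin_of_mem_nhds ?_⟩
        filter_upwards [h, hW.isOpen.mem_nhds hx] with y hy hyW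
        rw [hsW hyW, hy]
      · refine ⟨g, hg, mem_nhdsWithin_of_mem_nhds ?_⟩
        filter_upwards [hNcl.isOpen.mem_nhds hx] with y hy
        exact hsN hy
    · rw [himage]
      exact himg.union ⟨g.isClosed_image.2 hNcl.1, g.isOpen_image.2 hNcl.2⟩
    · rintro y (hy | hy)
      · obtain ⟨g', hg', h⟩ := hsl y hy
        exact ⟨g', List.mem_cons_of_mem _ hg', (hsW hy).trans h⟩
      · exact ⟨g, List.mem_cons_self, hsN hy⟩
    · rintro y ⟨hyV, hy⟩ g' hg' hU'
      rw [mem_union, not_or] at hy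
      rw [himage]
      rcases List.mem_cons.1 hg' with rfl | hg'
      · left
        by_contra h
        exact hy.2 ⟨⟨hyV, hy.1⟩, hU', h⟩
      · exact Or.inl (hmax y ⟨hyV, hy.1⟩ g' hg' hU')

/-- Either `V` embeds into `U` by a map that is locally in `Γ`, or some orbit of the finite group
`G` meets `V` at least as often as it meets `U`. -/
theorem exists_embedding_or_orbit {U V : Set X} (hU : IsClopen U) (hV : IsClopen V)
    {G : Subgroup (X ≃ₜ X)} (hG : G ≤ Γ) [Finite G] :
    (∃ s : X → X, InjOn s V ∧ MapsTo s V U ∧ LocallyIn Γ s V) ∨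
      ∃ y : X, (orbitSet G y ∩ U).encard ≤ (orbitSet G y ∩ V).encard := by
  have hfin : (G : Set (X ≃ₜ X)).Finite := toFinite (G : Set (X ≃ₜ X))
  obtain ⟨W, s, -, hWV, hinj, hmaps, hloc, -, hsl, hmax⟩ :=
    exists_greedy_matching (Γ := Γ) hU hV hfin.toFinset.toList (by
      intro g hg
      exact hG (by simpa using hg))
  by_cases hVW : V ⊆ W
  · left
    obtain rfl := hWV.antisymm hVW
    exact ⟨s, hinj, hmaps, hloc⟩
  · right
    obtain ⟨y, hyV, hyW⟩ := not_subset.1 hVW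
    refine ⟨y, ?_⟩
    have h1 : orbitSet G y ∩ U ⊆ s '' (orbitSet G y ∩ W) := by
      rintro _ ⟨⟨g, hg, rfl⟩, hgU⟩
      obtain ⟨w, hw, hsw⟩ := hmax y ⟨hyV, hyW⟩ g (by simpa using hg) hgU
      obtain ⟨g', hg', hw'⟩ := hsl w hw
      have hg'G : g' ∈ G := by simpa using hg'
      refine ⟨w, ⟨⟨g'⁻¹ * g, G.mul_mem (G.inv_mem hg'G) hg, ?_⟩, hw⟩, hsw⟩
      rw [Homeomorph.mul_apply, Homeomorph.inv_apply, ← hsw, hw', g'.symm_apply_apply]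
    calc (orbitSet G y ∩ U).encard ≤ (s '' (orbitSet G y ∩ W)).encard :=
          encard_le_encard h1
      _ ≤ (orbitSet G y ∩ W).encard := encard_image_le _ _
      _ ≤ (orbitSet G y ∩ V).encard :=
          encard_le_encard (inter_subset_inter_right _ hWV)

/-- The uniform measure on an orbit of a finite group `G` is a `G`-invariant probability measure. -/
theorem exists_orbit_measure [T1Space X] [MeasurableSpace X] [BorelSpace X]
    (G : Subgroup (X ≃ₜ X)) [Finite G] (y : X) {U V : Set X} (hU : IsClopen U) (hV : IsClopen V)
    (h : (orbitSet G y ∩ U).encard ≤ (orbitSet G y ∩ V).encard) :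
    ∃ μ : ProbabilityMeasure X, (∀ g ∈ G, (μ : Measure X).map g = μ) ∧
      (μ : Measure X) U ≤ (μ : Measure X) V := by
  set O := orbitSet G y with hO
  have hOfin : O.Finite := finite_orbitSet G y
  have hOm : MeasurableSet O := hOfin.measurableSet
  have hOne : O.Nonempty := ⟨y, 1, G.one_mem, rfl⟩
  refine ⟨⟨ProbabilityTheory.uniformOn O,
    ProbabilityTheory.isProbabilityMeasure_uniformOn hOfin hOne⟩, ?_, ?_⟩
  · intro g hg
    ext A hA
    have himg : g '' (O ∩ g ⁻¹' A) = O ∩ A := by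
      ext z
      constructor
      · rintro ⟨_, ⟨⟨k, hk, rfl⟩, hwA⟩, rfl⟩
        exact ⟨⟨g * k, G.mul_mem hg hk, rfl⟩, hwA⟩
      · rintro ⟨⟨k, hk, rfl⟩, hzA⟩
        exact ⟨g.symm (k y), ⟨⟨g⁻¹ * k, G.mul_mem (G.inv_mem hg) hk, rfl⟩,
          by simpa using hzA⟩, g.apply_symm_apply _⟩
    simp only [ProbabilityMeasure.coe_mk]
    rw [Measure.map_apply g.measurable hA, ProbabilityTheory.uniformOn,
      ProbabilityTheory.cond_apply hOm, ProbabilityTheory.cond_apply hOm,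
      Measure.count_apply (hOm.inter hA), Measure.count_apply (hOm.inter (g.measurable hA)),
      ← g.injective.encard_image]
    rw [himg]
  · simp only [ProbabilityMeasure.coe_mk]
    rw [ProbabilityTheory.uniformOn,
      ProbabilityTheory.cond_apply hOm, ProbabilityTheory.cond_apply hOm,
      Measure.count_apply (hOm.inter hU.isOpen.measurableSet),
      Measure.count_apply (hOm.inter hV.isOpen.measurableSet)]
    gcongr

/-- A nonempty open set is charged by every invariant probability measure of a countable minimal
group. -/
theorem IsMinimal.measure_pos [MeasurableSpace X] [BorelSpace X] (hmin : IsMinimal Γ)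
    (hcount : Countable Γ) {U : Set X} (hU : IsOpen U) (hne : U.Nonempty) {μ : Measure X}
    [IsProbabilityMeasure μ] (hμ : ∀ γ ∈ Γ, μ.map γ = μ) : 0 < μ U := by
  refine pos_iff_ne_zero.2 fun h0 => ?_
  have hcov : (univ : Set X) ⊆ ⋃ γ : Γ, (γ : X ≃ₜ X) ⁻¹' U := fun x _ => by
    obtain ⟨y, hyU, γ, hγ, rfl⟩ := (hmin x).inter_open_nonempty U hU hne
    exact mem_iUnion.2 ⟨⟨γ, hγ⟩, hyU⟩
  have : μ (univ : Set X) = 0 := by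
    refine measure_mono_null hcov (measure_iUnion_null fun γ => ?_)
    rw [← Measure.map_apply γ.1.measurable hU.measurableSet, hμ γ γ.2, h0]
  simp at this

variable [CompactSpace X] [T2Space X] [TotallyDisconnectedSpace X]
  [TopologicalSpace.MetrizableSpace X] [MeasurableSpace X] [BorelSpace X]

/-- A thin closed set embeds, locally in `Γ`, into every nonempty clopen set. Otherwise, for every
clopen neighbourhood `V` of the set and every finite subgroup of `Γ`, some finite orbit meets `V` at
least as often as `U`; a limit of the uniform measures on these orbits is an invariant measure
charging the set. -/
theorem exists_embedding_of_isThin (hΓ : IsAmple Γ) (hmin : IsMinimal Γ) {F U : Set X}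
    (hF : IsClosed F) (hthin : IsThin Γ F) (hU : IsClopen U) (hne : U.Nonempty) :
    ∃ s : X → X, InjOn s F ∧ MapsTo s F U ∧ LocallyIn Γ s F := by
  classical
  by_contra hcon
  -- the finite subgroups and the clopen neighbourhoods of `F`, indexed by directed sets
  let G : Finset (X ≃ₜ X) → Subgroup (X ≃ₜ X) := fun T =>
    Subgroup.closure ((T : Set (X ≃ₜ X)) ∩ Γ)
  have hGΓ : ∀ T, G T ≤ Γ := fun T => (Subgroup.closure_le _).2 inter_subset_right
  have hGfin : ∀ T, Finite (G T) := fun T => hΓ.locallyFinite _ (hGΓ T)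
    ((Subgroup.fg_iff _).2 ⟨_, rfl, T.finite_toSet.inter_of_left _⟩)
  let V : Finset (Set X) → Set X := fun 𝒱 => ⋂₀ {A ∈ (𝒱 : Set (Set X)) | IsClopen A ∧ F ⊆ A}
  have hVcl : ∀ 𝒱, IsClopen (V 𝒱) := fun 𝒱 => by
    refine ⟨isClosed_sInter fun A hA => hA.2.1.1, Set.Finite.isOpen_sInter
      (𝒱.finite_toSet.subset fun A hA => hA.1) fun A hA => hA.2.1.2⟩
  have hFV : ∀ 𝒱, F ⊆ V 𝒱 := fun 𝒱 => subset_sInter fun A hA => hA.2.2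
  have hμ : ∀ i : Finset (X ≃ₜ X) × Finset (Set X), ∃ μ : ProbabilityMeasure X,
      (∀ g ∈ G i.1, (μ : Measure X).map g = μ) ∧ (μ : Measure X) U ≤ (μ : Measure X) (V i.2) := by
    intro i
    have := hGfin i.1
    rcases exists_embedding_or_orbit hU (hVcl i.2) (hGΓ i.1) with ⟨s, h1, h2, h3⟩ | ⟨y, hy⟩
    · exact absurd ⟨s, h1.mono (hFV _), h2.mono_left (hFV _), h3.mono (hFV _)⟩ hcon
    · exact exists_orbit_measure (G i.1) y hU (hVcl i.2) hy
  choose μ hinv hle using hμ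
  obtain ⟨ν, hν⟩ := exists_clusterPt_of_compactSpace (map μ atTop)
  obtain ⟨L, hL, hlim⟩ := mapClusterPt_iff_ultrafilter.1 hν
  have hνinv : ∀ γ ∈ Γ, (ν : Measure X).map γ = ν := by
    intro γ hγ
    have h1 := ProbabilityMeasure.tendsto_map_of_tendsto_of_continuous μ ν hlim γ.continuous
    have h2 : ∀ᶠ i in (L : Filter _), (μ i).map γ.continuous.measurable.aemeasurable = μ i := by
      refine hL (mem_of_superset (Ici_mem_atTop (({γ} : Finset _), (∅ : Finset _))) ?_)
      intro i hi
      refine Subtype.ext (hinv i γ (Subgroup.subset_closure ⟨?_, hγ⟩))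
      exact hi.1 (Finset.mem_singleton_self γ)
    have h3 := tendsto_nhds_unique (h1.congr' h2) hlim
    exact congrArg Subtype.val h3
  have hνle : ∀ A : Set X, IsClopen A → F ⊆ A → (ν : Measure X) U ≤ (ν : Measure X) A := by
    intro A hA hFA
    have h1 := ProbabilityMeasure.tendsto_measure_of_isClopen_of_tendsto hlim hU
    have h2 := ProbabilityMeasure.tendsto_measure_of_isClopen_of_tendsto hlim hA
    have h3 : ν U ≤ ν A := by
      refine le_of_tendsto_of_tendsto h1 h2 ?_
      refine hL (mem_of_superset (Ici_mem_atTop ((∅ : Finset _), ({A} : Finset _))) ?_)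
      intro i hi
      have h4 : V i.2 ⊆ A := sInter_subset_of_mem ⟨hi.2 (Finset.mem_singleton_self A), hA, hFA⟩
      have h5 := (hle i).trans (measure_mono h4)
      rw [← ProbabilityMeasure.ennreal_coeFn_eq_coeFn_toMeasure,
        ← ProbabilityMeasure.ennreal_coeFn_eq_coeFn_toMeasure] at h5
      exact_mod_cast h5
    rw [← ProbabilityMeasure.ennreal_coeFn_eq_coeFn_toMeasure,
      ← ProbabilityMeasure.ennreal_coeFn_eq_coeFn_toMeasure]
    exact_mod_cast h3
  have hF0 : (ν : Measure X) F = 0 := hthin ν inferInstance hνinv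
  have hUpos := hmin.measure_pos hΓ.countable hU.isOpen hne hνinv
  obtain ⟨O, hFO, hO, hOlt⟩ := F.exists_isOpen_lt_of_lt (μ := (ν : Measure X)) _ (hF0 ▸ hUpos)
  obtain ⟨A, hA, hFA, hAO⟩ := exists_clopen_of_closed_subset_open hF hO hFO
  exact absurd (hνle A hA hFA) (not_le.2 ((measure_mono hAO).trans_lt hOlt))

/-- Thin closed sets have empty interior: a nonempty clopen set cannot be embedded, locally in a
locally finite group, into a proper subset of itself. -/
theorem interior_eq_empty_of_isThin [PerfectSpace X] (hΓ : IsAmple Γ) (hmin : IsMinimal Γ)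
    {F : Set X} (hF : IsClosed F) (hthin : IsThin Γ F) : interior F = ∅ := by
  by_contra hne
  obtain ⟨x, hx⟩ := nonempty_iff_ne_empty.2 hne
  obtain ⟨U, hU, hxU, hUF⟩ := compact_exists_isClopen_in_isOpen isOpen_interior hx
  obtain ⟨y, hyU, hyx⟩ := ((PerfectSpace.not_isolated x).nonempty_of_mem
    (inter_mem (mem_nhdsWithin_of_mem_nhds (hU.isOpen.mem_nhds hxU)) self_mem_nhdsWithin))
  obtain ⟨W, hW, hyW, hWsub⟩ := compact_exists_isClopen_in_isOpen
    (hU.isOpen.inter isOpen_compl_singleton) ⟨hyU, hyx⟩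
  obtain ⟨s, hinj, hmaps, hloc⟩ := exists_embedding_of_isThin hΓ hmin hF hthin hW ⟨y, hyW⟩
  have hUF' : U ⊆ F := hUF.trans interior_subset
  obtain ⟨f, hf, hP⟩ := exists_isLocallyConstant (D := X ≃ₜ X) hU.isClosed.isCompact
    (P := fun y γ => γ ∈ Γ ∧ s y = γ y) (fun x hx => by
      obtain ⟨γ, hγ, h⟩ := hloc.mono hUF' x hx
      exact ⟨γ, h.mono fun y hy => ⟨hγ, hy⟩⟩)
  have hGΓ : Subgroup.closure (range f ∩ Γ) ≤ Γ := (Subgroup.closure_le _).2 inter_subset_right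
  have := hΓ.locallyFinite _ hGΓ
    ((Subgroup.fg_iff _).2 ⟨_, rfl, hf.range_finite.inter_of_left _⟩)
  set G := Subgroup.closure (range f ∩ Γ)
  have hfin : (orbitSet G x ∩ U).Finite := (finite_orbitSet G x).inter_of_left _
  have hself : MapsTo s (orbitSet G x ∩ U) (orbitSet G x ∩ U) := by
    rintro z ⟨⟨g, hg, rfl⟩, hzU⟩
    refine ⟨⟨f (g x) * g, G.mul_mem (Subgroup.subset_closure ⟨mem_range_self _, (hP _ hzU).1⟩) hg,
      (hP _ hzU).2.symm⟩, (hWsub (hmaps (hUF' hzU))).1⟩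
  have heq : s '' (orbitSet G x ∩ U) = orbitSet G x ∩ U := eq_of_subset_of_ncard_le
    hself.image_subset (hinj.mono (inter_subset_right.trans hUF')).ncard_image.ge hfin
  have hx' : x ∈ s '' (orbitSet G x ∩ U) := by
    rw [heq]; exact ⟨⟨1, G.one_mem, rfl⟩, hxU⟩
  obtain ⟨z, hz, hzx⟩ := hx'
  exact (hWsub (hmaps (hUF' hz.2))).2 hzx

end Comparison

/-! ### Moving thin sets -/

section Thin

variable {X : Type*} [TopologicalSpace X] [MeasurableSpace X] {Γ : Subgroup (X ≃ₜ X)}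

theorem IsThin.mono {E F : Set X} (hF : IsThin Γ F) (h : E ⊆ F) : IsThin Γ E :=
  fun μ hμ hinv => measure_mono_null h (hF μ hμ hinv)

theorem IsThin.union {E F : Set X} (hE : IsThin Γ E) (hF : IsThin Γ F) : IsThin Γ (E ∪ F) :=
  fun μ hμ hinv => measure_union_null (hE μ hμ hinv) (hF μ hμ hinv)

variable [BorelSpace X] [CompactSpace X] [T2Space X] [TotallyDisconnectedSpace X]
  [TopologicalSpace.MetrizableSpace X] [PerfectSpace X]

theorem exists_isClopen_diff_thin (hΓ : IsAmple Γ) (hmin : IsMinimal Γ) {B F : Set X}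
    (hB : IsClopen B) (hne : B.Nonempty) (hF : IsClosed F) (hthin : IsThin Γ F) :
    ∃ U : Set X, IsClopen U ∧ U.Nonempty ∧ U ⊆ B \ F := by
  have h : (B \ F).Nonempty := by
    rw [nonempty_iff_ne_empty, Ne, sdiff_eq_empty]
    intro h
    have h1 := hB.isOpen.subset_interior_iff.2 h
    rw [interior_eq_empty_of_isThin hΓ hmin hF hthin] at h1
    exact hne.ne_empty (subset_empty_iff.1 h1)
  obtain ⟨x, hx⟩ := h
  obtain ⟨U, hU, hxU, hsub⟩ := compact_exists_isClopen_in_isOpen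
    (hB.isOpen.sdiff hF) hx
  exact ⟨U, hU, ⟨x, hxU⟩, hsub⟩

/-- Given a locally constant colouring `p` of a clopen set `B` and a locally constant colouring `f`
of a thin closed subset `F` by colours that occur in `B`, some element of `Γ` preserving `B` moves
every point of `F` to a point of the prescribed colour. -/
theorem exists_mem_recolor (hΓ : IsAmple Γ) (hmin : IsMinimal Γ) {B F : Set X} (hB : IsClopen B)
    (hF : IsClosed F) (hthin : IsThin Γ F) (hFB : F ⊆ B) {p f : X → ℕ} (hp : IsLocallyConstant p)
    (hf : ∀ y ∈ F, ∀ᶠ z in 𝓝[F] y, f z = f y) (hfp : ∀ y ∈ F, ∃ b ∈ B, p b = f y) :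
    ∃ γ ∈ Γ, (∀ y, γ y ∈ B ↔ y ∈ B) ∧ ∀ y ∈ F, p (γ y) = f y := by
  classical
  have H : ∀ j, ∃ s : X → X, (∃ b ∈ B, p b = j) →
      InjOn s F ∧ MapsTo s F ((B ∩ p ⁻¹' {j}) \ F) ∧ LocallyIn Γ s F := by
    intro j
    by_cases hj : ∃ b ∈ B, p b = j
    · obtain ⟨b, hb, hbj⟩ := hj
      obtain ⟨U, hU, hne, hsub⟩ := exists_isClopen_diff_thin hΓ hmin
        (hB.inter (hp.isClopen_fiber j)) ⟨b, hb, hbj⟩ hF hthin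
      obtain ⟨s, h1, h2, h3⟩ := exists_embedding_of_isThin hΓ hmin hF hthin hU hne
      exact ⟨s, fun _ => ⟨h1, h2.mono_right hsub, h3⟩⟩
    · exact ⟨id, fun h => absurd h hj⟩
  choose s hs using H
  have hmaps : ∀ y ∈ F, s (f y) y ∈ (B ∩ p ⁻¹' {f y}) \ F := fun y hy =>
    (hs _ (hfp y hy)).2.1 hy
  obtain ⟨σ, hσ, h1, h2⟩ := hΓ.full.exists_extension hF.isCompact (s := fun y => s (f y) y)
    (fun y hy => by
      obtain ⟨γ, hγ, h⟩ := (hs _ (hfp y hy)).2.2 y hy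
      refine ⟨γ, hγ, ?_⟩
      filter_upwards [h, hf y hy] with z hz hzf
      rw [hzf, hz])
    (fun y hy z hz hyz => by
      have h1 : p (s (f y) y) = f y := (hmaps y hy).1.2
      have h2 : p (s (f z) z) = f z := (hmaps z hz).1.2
      have h3 : f y = f z := by
        rw [← h1, ← h2]; exact congrArg p hyz
      refine (hs _ (hfp y hy)).1 hy hz ?_
      simpa only [h3] using hyz)
    (by
      rw [disjoint_left]
      rintro _ hy' ⟨y, hy, rfl⟩
      exact (hmaps y hy).2 hy')
    hB.isOpen hFB (by
      rintro _ ⟨y, hy, rfl⟩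
      exact (hmaps y hy).1.1)
  exact ⟨σ, hσ, apply_mem_iff_of_fixes_compl Subset.rfl h2, fun y hy => by
    rw [h1 hy]; exact (hmaps y hy).1.2⟩

/-- An injective map `s`, locally in `Γ`, between thin closed subsets `E₁` and `F` of a clopen set
`A` extends to an element of `Γ` that preserves `A` and moves the remaining part of a thin
set `E ⊇ E₁` off `F`. -/
theorem exists_mem_extend (hΓ : IsAmple Γ) (hmin : IsMinimal Γ) {A E F E₁ : Set X}
    (hA : IsClopen A) (hE : IsClosed E) (hF : IsClosed F) (hEthin : IsThin Γ E)
    (hFthin : IsThin Γ F) (hEA : E ⊆ A) (hFA : F ⊆ A) (hE₁E : E₁ ⊆ E) (hE₁ : IsClosed E₁)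
    (hE₀ : IsClosed (E \ E₁)) {s : X → X} (hs : LocallyIn Γ s E₁) (hinj : InjOn s E₁)
    (hmaps : MapsTo s E₁ F) :
    ∃ γ ∈ Γ, (∀ y, γ y ∈ A ↔ y ∈ A) ∧ EqOn γ s E₁ ∧ ∀ y ∈ E \ E₁, γ y ∉ F := by
  rcases A.eq_empty_or_nonempty with rfl | hne
  · have hE0 : E = ∅ := subset_empty_iff.1 hEA
    subst hE0
    have hE10 : E₁ = ∅ := subset_empty_iff.1 hE₁E
    subst hE10
    exact ⟨1, Γ.one_mem, fun y => Iff.rfl, eqOn_empty _ _, by simp⟩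
  obtain ⟨U, hU, hUne, hUsub⟩ := exists_isClopen_diff_thin hΓ hmin hA hne (hE.union hF)
    (hEthin.union hFthin)
  obtain ⟨s₁, hs₁inj, hs₁U, hs₁⟩ := exists_embedding_of_isThin hΓ hmin hE hEthin hU hUne
  -- first move `E` into `U`, away from `F`
  obtain ⟨β, hβ, hβs, hβA⟩ := hΓ.full.exists_extension hE.isCompact hs₁ hs₁inj
    (by
      rw [disjoint_left]
      rintro _ hy' ⟨y, hy, rfl⟩
      exact (hUsub (hs₁U hy)).2 (Or.inl hy'))
    hA.isOpen hEA (by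
      rintro _ ⟨y, hy, rfl⟩
      exact (hUsub (hs₁U hy)).1)
  have hβU : ∀ y ∈ E, β y ∈ U := fun y hy => by rw [hβs hy]; exact hs₁U hy
  have hUF : ∀ y ∈ U, y ∉ F := fun y hy h => (hUsub hy).2 (Or.inr h)
  have himage : ∀ z ∈ (s ∘ β.symm) '' (β '' E₁), z ∈ F := by
    rintro _ ⟨_, ⟨y, hy, rfl⟩, rfl⟩
    simpa using hmaps hy
  obtain ⟨α, hα, hαs, hαO⟩ := hΓ.full.exists_extension (E := β '' E₁) (s := s ∘ β.symm)
    (O := A \ (β '' (E \ E₁)))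
    (hE₁.isCompact.image β.continuous)
    (by
      rintro _ ⟨y, hy, rfl⟩
      obtain ⟨γ, hγ, h⟩ := hs y hy
      refine ⟨γ * β⁻¹, Γ.mul_mem hγ (Γ.inv_mem hβ), ?_⟩
      have ht : Tendsto β.symm (𝓝[β '' E₁] (β y)) (𝓝[E₁] y) := by
        refine tendsto_nhdsWithin_iff.2 ⟨?_, ?_⟩
        · have := β.symm.continuous.tendsto (β y)
          rw [β.symm_apply_apply] at this
          exact this.mono_left nhdsWithin_le_nhds
        · filter_upwards [self_mem_nhdsWithin] with z hz
          obtain ⟨w, hw, rfl⟩ := hz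
          simpa using hw
      exact ht.eventually h)
    (by
      rintro _ ⟨y, hy, rfl⟩ _ ⟨z, hz, rfl⟩ h
      simp only [Function.comp_apply, Homeomorph.symm_apply_apply] at h
      rw [hinj hy hz h])
    (by
      rw [disjoint_left]
      rintro _ ⟨y, hy, rfl⟩ h
      exact hUF _ (hβU y (hE₁E hy)) (himage _ h))
    (hA.isOpen.sdiff (β.isClosed_image.2 hE₀))
    (by
      rintro _ ⟨y, hy, rfl⟩
      refine ⟨(hUsub (hβU y (hE₁E hy))).1, ?_⟩
      rintro ⟨z, hz, hzy⟩
      exact hz.2 (β.injective hzy ▸ hy))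
    (by
      intro z hz
      refine ⟨hFA (himage z hz), ?_⟩
      rintro ⟨w, hw, rfl⟩
      exact hUF _ (hβU w hw.1) (himage _ hz))
  refine ⟨α * β, Γ.mul_mem hα hβ, fun y => ?_, fun y hy => ?_, fun y hy => ?_⟩
  · rw [Homeomorph.mul_apply, apply_mem_iff_of_fixes_compl sdiff_subset hαO,
      apply_mem_iff_of_fixes_compl Subset.rfl hβA]
  · rw [Homeomorph.mul_apply, hαs (mem_image_of_mem β hy), Function.comp_apply,
      β.symm_apply_apply]
  · rw [Homeomorph.mul_apply, hαO (β y) fun h => h.2 (mem_image_of_mem β hy)]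
    exact hUF _ (hβU y hy.1)

end Thin

/-! ### Local conjugacies between malleable sets -/

section PartialConj

variable {X : Type*} [TopologicalSpace X]

/-- The map `h` on `K` transports the partial maps of `K` induced by elements of `Γ` into maps that
are locally restrictions of elements of `Λ`. The condition `γ y ∈ K` for `y` near `x` makes étaleness
of `K` a part of the definition. -/
def LocallyIntertwines (Γ Λ : Subgroup (X ≃ₜ X)) (K : Set X) (h : X → X) : Prop :=
  ∀ γ ∈ Γ, ∀ x ∈ K, γ x ∈ K →
    ∃ l ∈ Λ, ∀ᶠ y in 𝓝[K] x, γ y ∈ K ∧ h (γ y) = l (h y)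

/-- `h` and `h'` restrict to mutually inverse homeomorphisms between the closed thin sets `K` and
`L` that intertwine, locally, the partial actions of `Γ` on `K` and of `Λ` on `L`. Only the values
of `h` on `K` and of `h'` on `L` matter. -/
structure IsPartialConj [MeasurableSpace X] (Γ Λ : Subgroup (X ≃ₜ X)) (K L : Set X)
    (h h' : X → X) : Prop where
  closed_left : IsClosed K
  closed_right : IsClosed L
  thin_left : IsThin Γ K
  thin_right : IsThin Λ L
  mapsTo_left : MapsTo h K L
  mapsTo_right : MapsTo h' L K
  left_inv : ∀ x ∈ K, h' (h x) = x
  right_inv : ∀ y ∈ L, h (h' y) = y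
  cont_left : ContinuousOn h K
  cont_right : ContinuousOn h' L
  inter_left : LocallyIntertwines Γ Λ K h
  inter_right : LocallyIntertwines Λ Γ L h'

theorem IsPartialConj.symm [MeasurableSpace X] {Γ Λ : Subgroup (X ≃ₜ X)} {K L : Set X}
    {h h' : X → X} (H : IsPartialConj Γ Λ K L h h') : IsPartialConj Λ Γ L K h' h :=
  ⟨H.2, H.1, H.4, H.3, H.6, H.5, H.8, H.7, H.10, H.9, H.12, H.11⟩

variable {Γ Λ : Subgroup (X ≃ₜ X)}

theorem IsEtale.eventually_mem {K : Set X} (hK : IsEtale Γ K) {γ : X ≃ₜ X} (hγ : γ ∈ Γ) (x : K)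
    (hx : γ x ∈ K) : ∀ᶠ y : K in 𝓝 x, γ y ∈ K := by
  have hcl : IsClopen {y : K | γ y ∈ K} := by
    convert hK γ⁻¹ (Γ.inv_mem hγ) univ isClopen_univ using 1
    ext y
    constructor
    · intro h
      exact ⟨⟨γ y, h⟩, mem_univ _, γ.symm_apply_apply _⟩
    · rintro ⟨x, -, hx⟩
      change γ y ∈ K
      rw [← hx, Homeomorph.inv_apply, γ.apply_symm_apply]
      exact x.2
  exact hcl.isOpen.mem_nhds hx

theorem subset_fullGroup (G : Subgroup (X ≃ₜ X)) : (G : Set (X ≃ₜ X)) ⊆ fullGroup G := by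
  intro g hg
  refine ⟨1, fun _ => univ, fun _ => g, fun _ => isClopen_univ, ?_, iUnion_const _,
    fun _ => ⟨hg, fun _ _ => rfl⟩⟩
  intro i j hij
  exact absurd (Subsingleton.elim i j) hij

/-- The homeomorphisms of `K` that are locally restrictions of elements of `Γ`. -/
def localGroup (Γ : Subgroup (X ≃ₜ X)) (K : Set X) : Subgroup (K ≃ₜ K) where
  carrier := {g | ∀ x : K, ∃ γ ∈ Γ, ∀ᶠ y in 𝓝 x, (g y : X) = γ y}
  mul_mem' := by
    intro g₁ g₂ h₁ h₂ x
    obtain ⟨γ₂, hγ₂, e₂⟩ := h₂ x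
    obtain ⟨γ₁, hγ₁, e₁⟩ := h₁ (g₂ x)
    refine ⟨γ₁ * γ₂, Γ.mul_mem hγ₁ hγ₂, ?_⟩
    filter_upwards [e₂, (g₂.continuous.tendsto x).eventually e₁] with y hy₂ hy₁
    rw [Homeomorph.mul_apply, Homeomorph.mul_apply, hy₁, hy₂]
  one_mem' := fun x => ⟨1, Γ.one_mem, Eventually.of_forall fun y => rfl⟩
  inv_mem' := by
    intro g hg x
    obtain ⟨γ, hγ, e⟩ := hg (g.symm x)
    refine ⟨γ⁻¹, Γ.inv_mem hγ, ?_⟩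
    filter_upwards [(g.symm.continuous.tendsto x).eventually e] with y hy
    rw [g.apply_symm_apply] at hy
    rw [Homeomorph.inv_apply, Homeomorph.inv_apply, hy, γ.symm_apply_apply]

theorem inducedGroup_le_localGroup {K : Set X} (hKcl : IsClosed K) (hK : IsEtale Γ K) :
    inducedGroup Γ K ≤ localGroup Γ K := by
  refine sInf_le ⟨Subset.antisymm ?_ (subset_fullGroup _), ?_⟩
  · rintro g ⟨n, U, γ, hU, -, hcov, hg⟩ x
    obtain ⟨i, hi⟩ := mem_iUnion.1 (hcov ▸ mem_univ x)
    obtain ⟨l, hl, e⟩ := (hg i).1 x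
    refine ⟨l, hl, ?_⟩
    filter_upwards [e, (hU i).isOpen.mem_nhds hi] with y hy hyU
    rw [(hg i).2 y hyU, hy]
  · intro γ hγ _ g hg x
    by_cases hx : γ x ∈ K
    · refine ⟨γ, hγ, ?_⟩
      filter_upwards [hK.eventually_mem hγ x hx] with y hy
      simp [hg, inducedMap, hy]
    · refine ⟨1, Γ.one_mem, ?_⟩
      have hopen : IsOpen {y : K | γ y ∉ K} :=
        hKcl.isOpen_compl.preimage (γ.continuous.comp continuous_subtype_val)
      filter_upwards [hopen.mem_nhds hx] with y hy
      have hy' : γ y ∉ K := hy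
      simp [hg, inducedMap, hy']

variable [CompactSpace X] [T2Space X] [TotallyDisconnectedSpace X]

/-- Near a point that it moves, an element of an ample group agrees with an involution of the
group. -/
theorem IsAmple.exists_involution (hΓ : IsAmple Γ) {γ : X ≃ₜ X} (hγ : γ ∈ Γ) {x : X}
    (hx : γ x ≠ x) : ∃ σ ∈ Γ, σ * σ = 1 ∧ ∀ᶠ y in 𝓝 x, σ y = γ y := by
  obtain ⟨O₁, O₂, hO₁, hO₂, h1, h2, hd⟩ := t2_separation hx
  obtain ⟨W, hW, hxW, hWsub⟩ := compact_exists_isClopen_in_isOpen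
    ((hO₁.preimage γ.continuous).inter hO₂) ⟨h1, h2⟩
  obtain ⟨σ, hσ, e, -, hinv⟩ := hΓ.full.exists_swap hW (s := γ)
    (fun y _ => ⟨γ, hγ, Eventually.of_forall fun _ => rfl⟩) γ.injective.injOn (by
      rw [disjoint_left]
      rintro _ hy' ⟨y, hy, rfl⟩
      exact disjoint_left.1 hd (hWsub hy).1 (hWsub hy').2)
  exact ⟨σ, hσ, hinv, mem_of_superset (hW.isOpen.mem_nhds hxW) fun y hy => e hy⟩

/-- A homeomorphism `K ≃ₜ L` that conjugates `Γ_K` into `Λ_L` intertwines the partial actions of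
`Γ` and `Λ` locally: near a point of `K` that `γ ∈ Γ` moves within `K`, the map `γ` coincides with
the restriction to `K` of an involution, hence with an element of `Γ_K`. -/
theorem locallyIntertwines_of_conjugate (hΓ : IsAmple Γ) {K L : Set X} (hKet : IsEtale Γ K)
    (hLcl : IsClosed L) (hLet : IsEtale Λ L) (e : K ≃ₜ L)
    (hconj : ∀ g ∈ inducedGroup Γ K, (e.symm.trans g).trans e ∈ inducedGroup Λ L) {h : X → X}
    (he : ∀ x : K, h x = e x) : LocallyIntertwines Γ Λ K h := by
  intro γ hγ x hx hγx
  have hev := hKet.eventually_mem hγ ⟨x, hx⟩ hγx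
  by_cases hfix : γ x = x
  · refine ⟨1, Λ.one_mem, ?_⟩
    have h1 : ∀ᶠ y in 𝓝[K] x, γ y = y :=
      mem_nhdsWithin_of_mem_nhds ((hΓ.isClopen_fixed γ hγ).isOpen.mem_nhds hfix)
    filter_upwards [h1, self_mem_nhdsWithin] with y hy hyK
    rw [hy]
    exact ⟨hyK, rfl⟩
  · obtain ⟨σ, hσ, hinv, hσγ⟩ := hΓ.exists_involution hγ hfix
    obtain ⟨g, hg⟩ := exists_homeomorph_inducedMap hKet hσ hinv
    obtain ⟨l, hl, hev2⟩ := inducedGroup_le_localGroup hLcl hLet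
      (hconj g (mem_inducedGroup hσ hinv hg)) (e ⟨x, hx⟩)
    refine ⟨l, hl, ?_⟩
    rw [nhdsWithin_eq_map_subtype_coe hx, eventually_map]
    filter_upwards [hev, (e.continuous.tendsto ⟨x, hx⟩).eventually hev2,
      (continuous_subtype_val.tendsto (⟨x, hx⟩ : K)).eventually hσγ] with y hy1 hy2 hy3
    refine ⟨hy1, ?_⟩
    have hgy : g y = ⟨γ y, hy1⟩ := by
      rw [hg]
      have : σ y ∈ K := by rw [hy3]; exact hy1
      rw [inducedMap, dif_pos this]
      exact Subtype.ext hy3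
    rw [he y, ← hy2, ← show ((⟨γ y, hy1⟩ : K) : X) = γ y from rfl, he, ← hgy]
    simp

open Classical in
theorem exists_isPartialConj [MeasurableSpace X] (hΓ : IsAmple Γ) (hΛ : IsAmple Λ) {K L : Set X}
    (hK : IsMalleable Γ K) (hL : IsMalleable Λ L) (e : K ≃ₜ L)
    (hconj : conjugate e (inducedGroup Γ K) = (inducedGroup Λ L : Set (L ≃ₜ L))) :
    ∃ h h' : X → X, (∀ x : K, h x = e x) ∧ IsPartialConj Γ Λ K L h h' := by
  let h : X → X := fun x => if hx : x ∈ K then e ⟨x, hx⟩ else x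
  let h' : X → X := fun y => if hy : y ∈ L then e.symm ⟨y, hy⟩ else y
  have hh : ∀ x : K, h x = e x := fun x => by simp [h]
  have hh' : ∀ y : L, h' y = e.symm y := fun y => by simp [h']
  refine ⟨h, h', hh, hK.isClosed, hL.isClosed, hK.thin, hL.thin, ?_, ?_, ?_, ?_, ?_, ?_, ?_, ?_⟩
  · intro x hx
    rw [hh ⟨x, hx⟩]
    exact (e ⟨x, hx⟩).2
  · intro y hy
    rw [hh' ⟨y, hy⟩]
    exact (e.symm ⟨y, hy⟩).2
  · intro x hx
    rw [hh ⟨x, hx⟩, hh', e.symm_apply_apply]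
  · intro y hy
    rw [hh' ⟨y, hy⟩, hh, e.apply_symm_apply]
  · rw [continuousOn_iff_continuous_domRestrict]
    exact (continuous_subtype_val.comp e.continuous).congr fun x => (hh x).symm
  · rw [continuousOn_iff_continuous_domRestrict]
    exact (continuous_subtype_val.comp e.symm.continuous).congr fun x => (hh' x).symm
  · refine locallyIntertwines_of_conjugate hΓ hK.etale hL.isClosed hL.etale e (fun g hg => ?_) hh
    exact hconj.subset ⟨g, hg, rfl⟩
  · refine locallyIntertwines_of_conjugate hΛ hL.etale hK.isClosed hK.etale e.symm
      (fun g hg => ?_) hh'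
    obtain ⟨f, hf, rfl⟩ := hconj.superset hg
    convert hf using 1
    ext x
    simp

end PartialConj

/-! ### Foldings and matchings -/

section Folding

variable {X : Type*} [TopologicalSpace X] {Γ Λ : Subgroup (X ≃ₜ X)}

/-- A folding of `X` along `Γ`: the fibres of `q` are finitely many clopen cells, and the
idempotent map `θ` sends each cell onto a cell by an element of `Γ`. The cells contained in the
image of `θ` are the base cells; each of them is the bottom of a tower, made of the cells that are
mapped onto it. -/
structure IsFolding (Γ : Subgroup (X ≃ₜ X)) (q : X → ℕ) (θ : X → X) : Prop where
  locConst : IsLocallyConstant q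
  idem : ∀ x, θ (θ x) = θ x
  exists_mem : ∀ x, ∃ γ ∈ Γ, ∀ y, q y = q x → θ y = γ y
  cell_map : ∀ x y, q x = q y → q (θ x) = q (θ y)
  onto : ∀ x b, q b = q (θ x) → ∃ x', q x' = q x ∧ θ x' = b

theorem IsFolding.fixed {q : X → ℕ} {θ : X → X} (hθ : IsFolding Γ q θ) {x b : X}
    (hb : q b = q (θ x)) : θ b = b := by
  obtain ⟨x', -, rfl⟩ := hθ.onto x b hb
  exact hθ.idem x'

theorem IsFolding.continuous {q : X → ℕ} {θ : X → X} (hθ : IsFolding Γ q θ) : Continuous θ := by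
  refine continuous_iff_continuousAt.2 fun x => ?_
  obtain ⟨γ, -, h⟩ := hθ.exists_mem x
  exact γ.continuous.continuousAt.congr ((hθ.locConst.eventually_eq x).mono fun y hy =>
    (h y hy).symm)

theorem IsFolding.isThin_image [MeasurableSpace X] [BorelSpace X] (hcount : Countable Γ)
    {q : X → ℕ} {θ : X → X} (hθ : IsFolding Γ q θ) {K : Set X} (hKcl : IsClosed K)
    (hK : IsThin Γ K) : IsThin Γ (θ '' K) := by
  intro μ hμ hinv
  have hsub : θ '' K ⊆ ⋃ γ : Γ, (γ : X ≃ₜ X) ⁻¹' K := by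
    rintro _ ⟨x, hx, rfl⟩
    obtain ⟨γ, hγ, h⟩ := hθ.exists_mem x
    refine mem_iUnion.2 ⟨⟨γ, hγ⟩⁻¹, ?_⟩
    rw [h x rfl]
    change γ.symm (γ x) ∈ K
    rwa [γ.symm_apply_apply]
  refine measure_mono_null hsub (measure_iUnion_null fun γ => ?_)
  rw [← Measure.map_apply γ.1.measurable hKcl.measurableSet, hinv γ γ.2]
  exact hK μ hμ hinv

/-- A folding restricts to an open map from an étale closed set onto its image. -/
theorem IsFolding.nhdsWithin_image_le [CompactSpace X] [T2Space X] {q : X → ℕ} {θ : X → X}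
    (hθ : IsFolding Γ q θ) {K : Set X} (hKcl : IsClosed K)
    (het : ∀ γ ∈ Γ, ∀ x ∈ K, γ x ∈ K → ∀ᶠ y in 𝓝[K] x, γ y ∈ K) {x : X} (hx : x ∈ K) :
    𝓝[θ '' K] (θ x) ≤ map θ (𝓝[K] x) := by
  intro s hs
  rw [mem_map] at hs
  have key : ∃ M ∈ 𝓝 (θ x), ∀ y ∈ K, θ y ∈ M → θ y ∈ s := by
    refine hKcl.isCompact.induction_on (p := fun T => ∃ M ∈ 𝓝 (θ x), ∀ y ∈ T, θ y ∈ M → θ y ∈ s)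
      ⟨univ, univ_mem, by simp⟩ ?_ ?_ ?_
    · rintro T T' hT ⟨M, hM, h⟩
      exact ⟨M, hM, fun y hy => h y (hT hy)⟩
    · rintro T T' ⟨M, hM, h⟩ ⟨M', hM', h'⟩
      refine ⟨M ∩ M', inter_mem hM hM', ?_⟩
      rintro y (hy | hy) hyM
      · exact h y hy hyM.1
      · exact h' y hy hyM.2
    · intro y hy
      by_cases hxy : θ y = θ x
      · obtain ⟨γ, hγ, hγθ⟩ := hθ.exists_mem y
        obtain ⟨δ, hδ, hδθ⟩ := hθ.exists_mem x
        have hyx : (δ⁻¹ * γ) y = x := by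
          rw [Homeomorph.mul_apply, Homeomorph.inv_apply, ← hγθ y rfl, hxy, hδθ x rfl,
            δ.symm_apply_apply]
        have hev := het (δ⁻¹ * γ) (Γ.mul_mem (Γ.inv_mem hδ) hγ) y hy (hyx.symm ▸ hx)
        have ht : Tendsto (δ⁻¹ * γ : X ≃ₜ X) (𝓝[K] y) (𝓝[K] x) := by
          refine tendsto_nhdsWithin_iff.2 ⟨?_, hev⟩
          have := (δ⁻¹ * γ : X ≃ₜ X).continuous.tendsto y
          rw [hyx] at this
          exact this.mono_left nhdsWithin_le_nhds
        refine ⟨_, (ht.eventually hs).and ((ht.eventually (mem_nhdsWithin_of_mem_nhds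
          (hθ.locConst.eventually_eq x))).and (mem_nhdsWithin_of_mem_nhds
          (hθ.locConst.eventually_eq y))), univ, univ_mem, ?_⟩
        rintro z ⟨hz1, hz2, hz3⟩ -
        have hz1' : θ ((δ⁻¹ * γ : X ≃ₜ X) z) ∈ s := hz1
        rwa [hδθ _ hz2, Homeomorph.mul_apply, Homeomorph.inv_apply, δ.apply_symm_apply,
          ← hγθ z hz3] at hz1'
      · obtain ⟨O₁, O₂, hO₁, hO₂, h1, h2, hd⟩ := t2_separation hxy
        refine ⟨θ ⁻¹' O₁, mem_nhdsWithin_of_mem_nhds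
          ((hO₁.preimage hθ.continuous).mem_nhds h1), O₂, hO₂.mem_nhds h2, ?_⟩
        intro z hz hz'
        exact absurd hz' (disjoint_left.1 hd hz)
  obtain ⟨M, hM, h⟩ := key
  refine mem_of_superset (inter_mem_nhdsWithin _ hM) ?_
  rintro _ ⟨⟨y, hy, rfl⟩, hyM⟩
  exact h y hy hyM

/-- A local conjugacy `h` between closed sets descends along foldings that identify corresponding
points. -/
theorem exists_descend [CompactSpace X] [T2Space X] {K : Set X} {h : X → X} (hKcl : IsClosed K)
    (hcont : ContinuousOn h K) (hinter : LocallyIntertwines Γ Λ K h)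
    {q r : X → ℕ} {θ η : X → X} (hθ : IsFolding Γ q θ) (hη : IsFolding Λ r η)
    (hfib : ∀ x ∈ K, ∀ x' ∈ K, θ x = θ x' → η (h x) = η (h x')) :
    ∃ k : X → X, (∀ x ∈ K, k (θ x) = η (h x)) ∧ ContinuousOn k (θ '' K) ∧
      LocallyIntertwines Γ Λ (θ '' K) k := by
  classical
  let k : X → X := fun b => if hb : b ∈ θ '' K then η (h hb.choose) else b
  have hk : ∀ x ∈ K, k (θ x) = η (h x) := fun x hx => by
    have hb : θ x ∈ θ '' K := mem_image_of_mem θ hx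
    have h1 : k (θ x) = η (h hb.choose) := dif_pos hb
    rw [h1]
    exact hfib _ hb.choose_spec.1 _ hx hb.choose_spec.2
  have hopen : ∀ x ∈ K, 𝓝[θ '' K] (θ x) ≤ map θ (𝓝[K] x) := fun x hx =>
    hθ.nhdsWithin_image_le hKcl (fun γ hγ x hx hγx => by
      obtain ⟨l, -, hl⟩ := hinter γ hγ x hx hγx
      exact hl.mono fun y hy => hy.1) hx
  refine ⟨k, hk, ?_, ?_⟩
  · rintro _ ⟨x, hx, rfl⟩
    refine Tendsto.mono_left ?_ (hopen x hx)
    rw [tendsto_map'_iff, hk x hx]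
    refine Tendsto.congr' (f₁ := η ∘ h) ?_ ?_
    · filter_upwards [self_mem_nhdsWithin] with y hy
      exact (hk y hy).symm
    · exact (hη.continuous.tendsto (h x)).comp (hcont x hx)
  · rintro γ hγ _ ⟨x, hx, rfl⟩ ⟨x', hx', hxx'⟩
    obtain ⟨σ, hσ, hσθ⟩ := hθ.exists_mem x
    obtain ⟨σ', hσ', hσθ'⟩ := hθ.exists_mem x'
    obtain ⟨ρ, hρ, hρη⟩ := hη.exists_mem (h x)
    obtain ⟨ρ', hρ', hρη'⟩ := hη.exists_mem (h x')
    have hγ' : σ'⁻¹ * γ * σ ∈ Γ := Γ.mul_mem (Γ.mul_mem (Γ.inv_mem hσ') hγ) hσ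
    set γ' : X ≃ₜ X := σ'⁻¹ * γ * σ with hγ'def
    have hσγ' : ∀ y, σ' (γ' y) = γ (σ y) := fun y => by
      simp only [hγ'def, Homeomorph.mul_apply, Homeomorph.inv_apply, Homeomorph.apply_symm_apply]
    have hγ'x : γ' x = x' := by
      apply σ'.injective
      rw [hσγ', ← hσθ x rfl, ← hσθ' x' rfl, hxx']
    obtain ⟨l, hl, hev⟩ := hinter γ' hγ' x hx (hγ'x.symm ▸ hx')
    refine ⟨ρ' * l * ρ⁻¹, Λ.mul_mem (Λ.mul_mem hρ' hl) (Λ.inv_mem hρ), ?_⟩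
    refine hopen x hx (mem_map.2 ?_)
    have ht : Tendsto γ' (𝓝[K] x) (𝓝[K] x') := by
      refine tendsto_nhdsWithin_iff.2 ⟨?_, hev.mono fun y hy => hy.1⟩
      have := γ'.continuous.tendsto x
      rw [hγ'x] at this
      exact this.mono_left nhdsWithin_le_nhds
    have ev1 : ∀ᶠ y in 𝓝[K] x, q y = q x :=
      mem_nhdsWithin_of_mem_nhds (hθ.locConst.eventually_eq x)
    have ev2 : ∀ᶠ y in 𝓝[K] x, q (γ' y) = q x' :=
      ht.eventually (mem_nhdsWithin_of_mem_nhds (hθ.locConst.eventually_eq x'))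
    have ev3 : ∀ᶠ y in 𝓝[K] x, r (h y) = r (h x) :=
      (hcont x hx).eventually (hη.locConst.eventually_eq (h x))
    have ev4 : ∀ᶠ y in 𝓝[K] x, r (h (γ' y)) = r (h x') :=
      ht.eventually ((hcont x' hx').eventually (hη.locConst.eventually_eq (h x')))
    filter_upwards [hev, ev1, ev2, ev3, ev4, self_mem_nhdsWithin] with y hy e1 e2 e3 e4 hyK
    have h1 : γ (θ y) = θ (γ' y) := by rw [hσθ y e1, hσθ' _ e2, hσγ']
    refine ⟨⟨γ' y, hy.1, h1.symm⟩, ?_⟩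
    rw [h1, hk _ hy.1, hρη' _ e4, hy.2, hk y hyK, hρη (h y) e3]
    simp only [Homeomorph.mul_apply, Homeomorph.inv_apply, Homeomorph.symm_apply_apply]

/-- The data of a pair of foldings of `X`, given by the cells of `q` and the map `θ` on the first
side and by the cells of `r` and the map `η` on the second side. The cells `q⁻¹ i` and `r⁻¹ i`
correspond to each other. -/
structure Stage (X : Type*) where
  /-- The cells on the first side. -/
  q : X → ℕ
  /-- The folding map on the first side. -/
  θ : X → X
  /-- The cells on the second side. -/
  r : X → ℕ
  /-- The folding map on the second side. -/
  η : X → X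

/-- The same pair of foldings with the two sides exchanged. -/
def Stage.swap {X : Type*} (S : Stage X) : Stage X := ⟨S.r, S.η, S.q, S.θ⟩

/-- The pair of foldings `S`, along `Γ` and along `Λ`, is a combinatorial isomorphism that is
compatible with the isomorphism `φ` of the relations on clopen sets and with the map `h` on `K`:
the foldings act in the same way on the cells, `φ` sends base cells to equivalents of the
corresponding base cells, `h` respects the cells, and points of `K` are identified by the first
folding if and only if their images are identified by the second. -/
structure IsMatching (Γ Λ : Subgroup (X ≃ₜ X)) (φ : X ≃ₜ X) (K : Set X) (h : X → X)
    (S : Stage X) : Prop where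
  left : IsFolding Γ S.q S.θ
  right : IsFolding Λ S.r S.η
  total_left : ∀ x, ∃ y, S.q x = S.r y
  total_right : ∀ y, ∃ x, S.q x = S.r y
  cross : ∀ x y, S.q x = S.r y → S.q (S.θ x) = S.r (S.η y)
  equi : ∀ x, EquiDec Λ (φ '' {b | S.q b = S.q (S.θ x)}) {c | S.r c = S.q (S.θ x)}
  cell : ∀ x ∈ K, S.r (h x) = S.q x
  fib : ∀ x ∈ K, ∀ x' ∈ K, (S.θ x = S.θ x' ↔ S.η (h x) = S.η (h x'))

/-- `T` refines `S`: its cells are finer, on both sides in the same way, it folds further, and the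
cells of `T` are obtained by pulling back a partition of the base of `S`. -/
structure Extends (S T : Stage X) : Prop where
  refines : ∀ x y, T.q x = T.r y → S.q x = S.r y
  cross : ∀ x y, T.q x = T.r y → T.q (S.θ x) = T.r (S.η y)
  lift : ∀ x y, S.q x = S.r y → T.q (S.θ x) = T.r (S.η y) → T.q x = T.r y
  fold_left : ∀ x, T.θ (S.θ x) = T.θ x
  fold_right : ∀ y, T.η (S.η y) = T.η y

theorem Extends.swap {X : Type*} {S T : Stage X} (H : Extends S T) : Extends S.swap T.swap where
  refines x y h := (H.refines y x h.symm).symm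
  cross x y h := (H.cross y x h.symm).symm
  lift x y h h' := (H.lift y x h.symm h'.symm).symm
  fold_left := H.fold_right
  fold_right := H.fold_left

theorem Extends.trans {X : Type*} {S T U : Stage X} (H : Extends S T) (H' : Extends T U) :
    Extends S U where
  refines x y h := H.refines x y (H'.refines x y h)
  cross x y h := by
    refine H'.lift _ _ (H.cross _ _ (H'.refines x y h)) ?_
    rw [H.fold_left, H.fold_right]
    exact H'.cross x y h
  lift x y h h' := by
    refine H'.lift x y (H.lift x y h (H'.refines _ _ h')) ?_
    have := H'.cross _ _ h'
    rwa [H.fold_left, H.fold_right] at this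
  fold_left x := by rw [← H'.fold_left (S.θ x), H.fold_left, H'.fold_left]
  fold_right y := by rw [← H'.fold_right (S.η y), H.fold_right, H'.fold_right]

theorem IsMatching.extends_refl {φ : X ≃ₜ X} {K : Set X} {h : X → X} {S : Stage X}
    (H : IsMatching Γ Λ φ K h S) : Extends S S :=
  ⟨fun _ _ h => h, H.cross, fun _ _ h _ => h, H.left.idem, H.right.idem⟩

theorem EquiDec.symm {A B : Set X} (h : EquiDec Γ A B) : EquiDec Γ B A := by
  obtain ⟨γ, hγ, rfl⟩ := h
  exact ⟨γ⁻¹, Γ.inv_mem hγ, by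
    rw [image_image]; simp [Homeomorph.inv_apply]⟩

theorem EquiDec.trans {A B C : Set X} (h : EquiDec Γ A B) (h' : EquiDec Γ B C) :
    EquiDec Γ A C := by
  obtain ⟨γ, hγ, rfl⟩ := h
  obtain ⟨δ, hδ, rfl⟩ := h'
  exact ⟨δ * γ, Γ.mul_mem hδ hγ, by rw [image_image]; rfl⟩

/-- Exchanging the two sides of a matching replaces `φ` and `h` by their inverses. -/
theorem IsMatching.swap [MeasurableSpace X] {φ : X ≃ₜ X}
    (hφ : ∀ A B : Set X, IsClopen A → IsClopen B →
      (EquiDec Γ A B ↔ EquiDec Λ (φ '' A) (φ '' B)))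
    {K L : Set X} {h h' : X → X} (hh : IsPartialConj Γ Λ K L h h') {S : Stage X}
    (H : IsMatching Γ Λ φ K h S) : IsMatching Λ Γ φ.symm L h' S.swap where
  left := H.right
  right := H.left
  total_left y := (H.total_right y).imp fun _ => Eq.symm
  total_right x := (H.total_left x).imp fun _ => Eq.symm
  cross y x h := (H.cross x y h.symm).symm
  equi y := by
    obtain ⟨x, hx⟩ := H.total_right y
    have h1 := H.equi x
    rw [H.cross x y hx] at h1
    refine EquiDec.symm ((hφ _ _ (H.left.locConst.isClopen_fiber _) ?_).2 ?_)
    · exact ⟨φ.symm.isClosed_image.2 (H.right.locConst.isClosed_fiber _),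
        φ.symm.isOpen_image.2 (H.right.locConst.isOpen_fiber _)⟩
    · rw [image_image φ]
      simpa [Stage.swap] using h1
  cell y hy := by
    have := H.cell _ (hh.mapsTo_right hy)
    rw [hh.right_inv y hy] at this
    exact this.symm
  fib y hy y' hy' := by
    have := H.fib _ (hh.mapsTo_right hy) _ (hh.mapsTo_right hy')
    rw [hh.right_inv y hy, hh.right_inv y' hy'] at this
    exact this.symm

/-- A matching turns the partial conjugacy `h` between `K` and `L` into one between the images of
`K` and `L` in the bases of the two foldings. -/
theorem IsMatching.descend [CompactSpace X] [T2Space X] [MeasurableSpace X] [BorelSpace X]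
    (hΓ : IsAmple Γ) (hΛ : IsAmple Λ) {φ : X ≃ₜ X} {K L : Set X} {h h' : X → X}
    (hh : IsPartialConj Γ Λ K L h h') {S : Stage X} (H : IsMatching Γ Λ φ K h S) :
    ∃ k k' : X → X, IsPartialConj Γ Λ (S.θ '' K) (S.η '' L) k k' ∧
      (∀ x ∈ K, k (S.θ x) = S.η (h x)) ∧ ∀ y ∈ L, k' (S.η y) = S.θ (h' y) := by
  obtain ⟨k, hk, hkc, hki⟩ := exists_descend hh.closed_left hh.cont_left hh.inter_left H.left
    H.right fun x hx x' hx' => (H.fib x hx x' hx').1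
  obtain ⟨k', hk', hkc', hki'⟩ := exists_descend hh.closed_right hh.cont_right hh.inter_right
    H.right H.left fun y hy y' hy' e => by
      refine (H.fib _ (hh.mapsTo_right hy) _ (hh.mapsTo_right hy')).2 ?_
      rwa [hh.right_inv y hy, hh.right_inv y' hy']
  refine ⟨k, k', ⟨(hh.closed_left.isCompact.image H.left.continuous).isClosed,
    (hh.closed_right.isCompact.image H.right.continuous).isClosed,
    H.left.isThin_image hΓ.countable hh.closed_left hh.thin_left,
    H.right.isThin_image hΛ.countable hh.closed_right hh.thin_right,
    ?_, ?_, ?_, ?_, hkc, hkc', hki, hki'⟩, hk, hk'⟩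
  · rintro _ ⟨x, hx, rfl⟩
    rw [hk x hx]
    exact mem_image_of_mem _ (hh.mapsTo_left hx)
  · rintro _ ⟨y, hy, rfl⟩
    rw [hk' y hy]
    exact mem_image_of_mem _ (hh.mapsTo_right hy)
  · rintro _ ⟨x, hx, rfl⟩
    rw [hk x hx, hk' _ (hh.mapsTo_left hx), hh.left_inv x hx]
  · rintro _ ⟨y, hy, rfl⟩
    rw [hk' y hy, hk _ (hh.mapsTo_right hy), hh.right_inv y hy]

end Folding

/-! ### Refining the base of a matching -/

section Refine

variable {X : Type*} [TopologicalSpace X] {Γ Λ : Subgroup (X ≃ₜ X)}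

theorem _root_.IsLocallyConstant.diag {P : ℕ → X → ℕ} (hP : ∀ i, IsLocallyConstant (P i))
    {r : X → ℕ} (hr : IsLocallyConstant r) : IsLocallyConstant fun y => P (r y) y := by
  rw [IsLocallyConstant.iff_eventually_eq]
  intro y
  filter_upwards [hr.eventually_eq y, (hP (r y)).eventually_eq y] with z hz hz'
  rw [hz, hz']

/-- A partition of the base of a folding pulls back to a refinement of the cells. -/
theorem IsFolding.refine {q : X → ℕ} {θ : X → X} (hθ : IsFolding Γ q θ) {p : X → ℕ}
    (hp : IsLocallyConstant p) : IsFolding Γ (fun x => Nat.pair (q x) (p (θ x))) θ where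
  locConst := hθ.locConst.comp₂ (hp.comp_continuous hθ.continuous) Nat.pair
  idem := hθ.idem
  exists_mem x := by
    obtain ⟨γ, hγ, h⟩ := hθ.exists_mem x
    exact ⟨γ, hγ, fun y hy => h y (Nat.pair_eq_pair.1 hy).1⟩
  cell_map x y h := by
    rw [Nat.pair_eq_pair] at h
    rw [hθ.cell_map x y h.1, hθ.idem, hθ.idem, h.2]
  onto x b hb := by
    rw [Nat.pair_eq_pair] at hb
    obtain ⟨x', hx', rfl⟩ := hθ.onto x b hb.1
    rw [hθ.idem, hθ.idem] at hb
    exact ⟨x', by rw [hx', hb.2], rfl⟩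

theorem IsMatching.cell_descend {φ : X ≃ₜ X} {K : Set X} {h k : X → X} {S : Stage X}
    (H : IsMatching Γ Λ φ K h S) (hk : ∀ x ∈ K, k (S.θ x) = S.η (h x)) :
    ∀ b ∈ S.θ '' K, S.r (k b) = S.q b := by
  rintro _ ⟨x, hx, rfl⟩
  rw [hk x hx]
  exact (H.cross _ _ (H.cell x hx).symm).symm

variable [CompactSpace X] [T2Space X] [TotallyDisconnectedSpace X]
  [TopologicalSpace.MetrizableSpace X] [PerfectSpace X] [MeasurableSpace X] [BorelSpace X]

/-- A partition `p` of a base cell is matched by a partition of the corresponding base cell that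
is compatible with `h`: an arbitrary matching partition is corrected on the thin set `L`. -/
theorem IsMatching.exists_partition (hΓ : IsAmple Γ) (hΛ : IsAmple Λ) (hmin : IsMinimal Λ)
    {φ : X ≃ₜ X} {K L : Set X} {h h' : X → X} (hh : IsPartialConj Γ Λ K L h h') {S : Stage X}
    (H : IsMatching Γ Λ φ K h S) {p : X → ℕ} (hp : IsLocallyConstant p) (i : ℕ)
    (hi : ∃ x, S.q (S.θ x) = i) :
    ∃ p' : X → ℕ, IsLocallyConstant p' ∧
      (∀ j, EquiDec Λ (φ '' {b | S.q b = i ∧ p b = j}) {c | S.r c = i ∧ p' c = j}) ∧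
      ∀ x ∈ K, S.q (S.θ x) = i → p' (S.η (h x)) = p (S.θ x) := by
  obtain ⟨k, k', hkk, hk, hk'⟩ := H.descend hΓ hΛ hh
  have hcell := H.cell_descend hk
  have hcell' : ∀ c ∈ S.η '' L, S.q (k' c) = S.r c := fun c hc => by
    rw [← hcell _ (hkk.mapsTo_right hc), hkk.right_inv c hc]
  obtain ⟨x, hx⟩ := hi
  obtain ⟨μ, hμ, hμe⟩ := H.equi x
  rw [hx] at hμe
  have hμi : ∀ b, S.r (μ (φ b)) = i ↔ S.q b = i := by
    intro b
    constructor
    · intro hb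
      have : μ (φ b) ∈ μ '' (φ '' {b | S.q b = i}) := hμe ▸ hb
      obtain ⟨_, ⟨b', hb', rfl⟩, e⟩ := this
      rwa [← φ.injective (μ.injective e)]
    · intro hb
      have : μ (φ b) ∈ {c | S.r c = i} := hμe ▸ mem_image_of_mem μ (mem_image_of_mem φ hb)
      exact this
  obtain ⟨l, hl, hlB, hlF⟩ := exists_mem_recolor hΛ hmin
    (B := {c | S.r c = i}) (F := S.η '' L ∩ {c | S.r c = i})
    (p := fun c => p (φ.symm (μ.symm c))) (f := fun c => p (k' c))
    (H.right.locConst.isClopen_fiber i)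
    (hkk.closed_right.inter (H.right.locConst.isClosed_fiber i))
    (hkk.thin_right.mono inter_subset_left) inter_subset_right
    (hp.comp_continuous (φ.symm.continuous.comp μ.symm.continuous))
    (fun y hy => ((hkk.cont_right y hy.1).mono inter_subset_left).eventually
      (hp.eventually_eq (k' y)))
    (fun y hy => ⟨μ (φ (k' y)), (hμi _).2 ((hcell' y hy.1).trans hy.2), by simp⟩)
  refine ⟨fun c => p (φ.symm (μ.symm (l c))),
    hp.comp_continuous (φ.symm.continuous.comp (μ.symm.continuous.comp l.continuous)), ?_, ?_⟩
  · intro j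
    refine ⟨l⁻¹ * μ, Λ.mul_mem (Λ.inv_mem hl) hμ, ?_⟩
    ext c
    constructor
    · rintro ⟨_, ⟨b, ⟨hb, hbj⟩, rfl⟩, rfl⟩
      rw [Homeomorph.mul_apply, Homeomorph.inv_apply]
      refine ⟨(hlB _).1 ?_, ?_⟩
      · change S.r _ = i
        rw [l.apply_symm_apply, hμi, hb]
      · simpa using hbj
    · rintro ⟨hc, hcj⟩
      refine ⟨μ.symm (l c), ⟨φ.symm (μ.symm (l c)), ⟨?_, hcj⟩, φ.apply_symm_apply _⟩, ?_⟩
      · rw [← hμi, φ.apply_symm_apply, μ.apply_symm_apply]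
        exact (hlB c).2 hc
      · rw [Homeomorph.mul_apply, Homeomorph.inv_apply, μ.apply_symm_apply, l.symm_apply_apply]
  · intro x hx hxi
    have h1 := hlF (S.η (h x)) ⟨mem_image_of_mem _ (hh.mapsTo_left hx), by
      change S.r _ = i
      rw [← hxi]
      exact (H.cross _ _ (H.cell x hx).symm).symm⟩
    rw [hk' _ (hh.mapsTo_left hx), hh.left_inv x hx] at h1
    exact h1

/-- Every partition `p` of the base on the first side can be matched on the second side, which gives
a matching with refined cells and the same folding on the first side. -/
theorem IsMatching.exists_refine (hΓ : IsAmple Γ) (hΛ : IsAmple Λ) (hmin : IsMinimal Λ)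
    {φ : X ≃ₜ X} {K L : Set X} {h h' : X → X} (hh : IsPartialConj Γ Λ K L h h') {S : Stage X}
    (H : IsMatching Γ Λ φ K h S) {p : X → ℕ} (hp : IsLocallyConstant p) :
    ∃ T : Stage X, IsMatching Γ Λ φ K h T ∧ Extends S T ∧
      T.q = (fun x => Nat.pair (S.q x) (p (S.θ x))) ∧ T.θ = S.θ := by
  classical
  have H1 : ∀ i, ∃ p' : X → ℕ, IsLocallyConstant p' ∧ ((∃ x, S.q (S.θ x) = i) →
      (∀ j, EquiDec Λ (φ '' {b | S.q b = i ∧ p b = j}) {c | S.r c = i ∧ p' c = j}) ∧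
      ∀ x ∈ K, S.q (S.θ x) = i → p' (S.η (h x)) = p (S.θ x)) := by
    intro i
    by_cases hi : ∃ x, S.q (S.θ x) = i
    · obtain ⟨p', h1, h2⟩ := H.exists_partition hΓ hΛ hmin hh hp i hi
      exact ⟨p', h1, fun _ => h2⟩
    · exact ⟨fun _ => 0, IsLocallyConstant.const 0, fun h => absurd h hi⟩
  choose P hPl hP using H1
  have hequi : ∀ x j, EquiDec Λ (φ '' {b | S.q b = S.q (S.θ x) ∧ p b = j})
      {c | S.r c = S.q (S.θ x) ∧ P (S.q (S.θ x)) c = j} := fun x j => (hP _ ⟨x, rfl⟩).1 j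
  have hp' := IsLocallyConstant.diag hPl H.right.locConst
  set p' : X → ℕ := fun c => P (S.r c) c with hp'def
  refine ⟨⟨fun x => Nat.pair (S.q x) (p (S.θ x)), S.θ,
    fun y => Nat.pair (S.r y) (p' (S.η y)), S.η⟩,
    ⟨H.left.refine hp, H.right.refine hp', ?_, ?_, ?_, ?_, ?_, H.fib⟩, ?_, rfl, rfl⟩
  · intro x
    obtain ⟨y, hy⟩ := H.total_left x
    obtain ⟨l, -, hl⟩ := hequi x (p (S.θ x))
    have hc : l (φ (S.θ x)) ∈ {c | S.r c = S.q (S.θ x) ∧ P (S.q (S.θ x)) c = p (S.θ x)} :=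
      hl ▸ mem_image_of_mem l (mem_image_of_mem φ ⟨rfl, rfl⟩)
    obtain ⟨y', hy', hηy'⟩ := H.right.onto y _ (hc.1.trans (H.cross x y hy))
    refine ⟨y', Nat.pair_eq_pair.2 ⟨hy.trans hy'.symm, ?_⟩⟩
    rw [hηy', hp'def]
    simp only
    rw [hc.1, hc.2]
  · intro y
    obtain ⟨x, hx⟩ := H.total_right y
    have hxy := H.cross x y hx
    obtain ⟨l, -, hl⟩ := hequi x (p' (S.η y))
    have hc : S.η y ∈ l '' (φ '' {b | S.q b = S.q (S.θ x) ∧ p b = p' (S.η y)}) := by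
      rw [hl]
      exact ⟨hxy.symm, by rw [hxy]⟩
    obtain ⟨_, ⟨b, ⟨hb, hbj⟩, rfl⟩, -⟩ := hc
    obtain ⟨x', hx', hθx'⟩ := H.left.onto x b hb
    exact ⟨x', Nat.pair_eq_pair.2 ⟨hx'.trans hx, by rw [hθx', hbj]⟩⟩
  · intro x y hxy
    obtain ⟨h1, h2⟩ := Nat.pair_eq_pair.1 hxy
    simp only
    rw [H.left.idem, H.right.idem, h2, H.cross x y h1]
  · intro x
    obtain ⟨y, hy⟩ := H.total_left x
    have hxy := H.cross x y hy
    convert hequi x (p (S.θ (S.θ x))) using 2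
    · congr 1
      ext b
      simp only [Nat.pair_eq_pair]
      refine and_congr_right fun hb => ?_
      rw [H.left.fixed hb]
    · ext c
      simp only [Nat.pair_eq_pair]
      refine and_congr_right fun hc => ?_
      rw [H.right.fixed (hc.trans hxy), hp'def]
      simp only
      rw [hc]
  · intro x hx
    have h1 := H.cell x hx
    have h2 := H.cross _ _ h1.symm
    refine Nat.pair_eq_pair.2 ⟨h1, ?_⟩
    rw [hp'def]
    simp only
    rw [← h2]
    exact (hP _ ⟨x, rfl⟩).2 x hx rfl
  · refine ⟨fun x y hxy => (Nat.pair_eq_pair.1 hxy).1, ?_, ?_, H.left.idem, H.right.idem⟩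
    · intro x y hxy
      obtain ⟨h1, h2⟩ := Nat.pair_eq_pair.1 hxy
      simp only
      rw [H.left.idem, H.right.idem, h2, H.cross x y h1]
    · intro x y h1 h2
      obtain ⟨-, h3⟩ := Nat.pair_eq_pair.1 h2
      rw [H.left.idem, H.right.idem] at h3
      exact Nat.pair_eq_pair.2 ⟨h1, h3⟩

end Refine

/-! ### Merging two towers of a matching -/

section Merge

variable {X : Type*} [TopologicalSpace X] {Γ Λ : Subgroup (X ≃ₜ X)}

/-- Composing a folding with an element `τ` that maps a base cell `j` onto another base cell `i`
merges the tower over `j` into the tower over `i`. -/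
theorem IsFolding.merge {q : X → ℕ} {θ : X → X} (hθ : IsFolding Γ q θ) {i j : ℕ} (hij : j ≠ i)
    (hi : ∀ b, q b = i → θ b = b) {τ : X ≃ₜ X} (hτ : τ ∈ Γ) (hτij : ∀ b, q (τ b) = i ↔ q b = j) :
    IsFolding Γ q fun x => if q (θ x) = j then τ (θ x) else θ x where
  locConst := hθ.locConst
  idem x := by
    by_cases hx : q (θ x) = j
    · have h1 := (hτij _).2 hx
      have h2 := hi _ h1
      rw [if_pos hx, h2, h1, if_neg hij.symm]
    · rw [if_neg hx, hθ.idem, if_neg hx]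
  exists_mem x := by
    obtain ⟨γ, hγ, h⟩ := hθ.exists_mem x
    by_cases hx : q (θ x) = j
    · refine ⟨τ * γ, Γ.mul_mem hτ hγ, fun y hy => ?_⟩
      rw [if_pos ((hθ.cell_map y x hy).trans hx), h y hy, Homeomorph.mul_apply]
    · refine ⟨γ, hγ, fun y hy => ?_⟩
      rw [if_neg (fun h => hx ((hθ.cell_map y x hy).symm.trans h)), h y hy]
  cell_map x y h := by
    have hxy := hθ.cell_map x y h
    by_cases hx : q (θ x) = j
    · rw [if_pos hx, if_pos (hxy.symm.trans hx), (hτij _).2 hx, (hτij _).2 (hxy.symm.trans hx)]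
    · rw [if_neg hx, if_neg (fun h => hx (hxy.trans h)), hxy]
  onto x b hb := by
    by_cases hx : q (θ x) = j
    · rw [if_pos hx, (hτij _).2 hx] at hb
      have h1 : q (τ.symm b) = j := by rw [← hτij, τ.apply_symm_apply, hb]
      obtain ⟨x', hx', hb'⟩ := hθ.onto x _ (h1.trans hx.symm)
      refine ⟨x', hx', ?_⟩
      rw [hb', if_pos h1, τ.apply_symm_apply]
    · rw [if_neg hx] at hb
      obtain ⟨x', hx', hb'⟩ := hθ.onto x b hb
      refine ⟨x', hx', ?_⟩
      rw [hb', if_neg (fun h => hx (hb.symm.trans h))]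

theorem IsThin.image [MeasurableSpace X] [BorelSpace X] {F : Set X} (hF : IsThin Γ F)
    (hFcl : IsClosed F) {γ : X ≃ₜ X} (hγ : γ ∈ Γ) : IsThin Γ (γ '' F) := by
  intro μ hμ hinv
  have h1 : γ '' F = (γ⁻¹ : X ≃ₜ X) ⁻¹' F := by
    rw [γ.image_eq_preimage_symm]; rfl
  rw [h1, ← Measure.map_apply (γ⁻¹ : X ≃ₜ X).measurable hFcl.measurableSet,
    hinv _ (Γ.inv_mem hγ)]
  exact hF μ hμ hinv

/-- The points that an element of `Γ` moves out of an étale closed set form a closed set. -/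
theorem LocallyIntertwines.isClosed_escape {K : Set X} {h : X → X} (hKcl : IsClosed K)
    (hinter : LocallyIntertwines Γ Λ K h) {τ : X ≃ₜ X} (hτ : τ ∈ Γ) :
    IsClosed {b | b ∈ K ∧ τ b ∉ K} := by
  refine isClosed_of_closure_subset fun b hb => ?_
  have hbK : b ∈ K := closure_minimal (fun _ h => h.1) hKcl hb
  refine ⟨hbK, fun hτb => ?_⟩
  obtain ⟨l, -, hl⟩ := hinter τ hτ b hbK hτb
  rw [eventually_nhdsWithin_iff] at hl
  obtain ⟨y, hy, hy'⟩ := ((mem_closure_iff_frequently.1 hb).and_eventually hl).exists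
  exact hy.2 (hy' hy.1).1

variable [CompactSpace X] [T2Space X] [TotallyDisconnectedSpace X]
  [TopologicalSpace.MetrizableSpace X] [PerfectSpace X] [MeasurableSpace X] [BorelSpace X]

/-- An element `τ` of `Γ` that maps a clopen set `B` onto a clopen set `A` is matched by an element
of `Λ`, which maps the corresponding clopen set `B'` onto `A'` and acts on `L ∩ B'` in the way that
`τ` acts on `K ∩ B`. -/
theorem IsPartialConj.exists_matching_element (hΛ : IsAmple Λ) (hmin : IsMinimal Λ)
    {K L : Set X} {h h' : X → X} (hh : IsPartialConj Γ Λ K L h h') {A B A' B' : Set X}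
    (hA' : IsClopen A') (hB' : IsClopen B')
    (hhA : ∀ x ∈ K, h x ∈ A' ↔ x ∈ A) (hhB : ∀ x ∈ K, h x ∈ B' ↔ x ∈ B)
    (hBA' : EquiDec Λ B' A') {τ : X ≃ₜ X} (hτ : τ ∈ Γ) (hτBA : ∀ b, τ b ∈ A ↔ b ∈ B) :
    ∃ l ∈ Λ, (∀ c, l c ∈ A' ↔ c ∈ B') ∧ ∀ b ∈ K, b ∈ B →
      (τ b ∈ K → l (h b) = h (τ b)) ∧ (τ b ∉ K → l (h b) ∉ L) := by
  obtain ⟨μ, hμ, hμe⟩ := hBA'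
  have hμA : ∀ c, μ c ∈ A' ↔ c ∈ B' := fun c => by
    rw [← hμe, μ.injective.mem_set_image]
  have hhB' : ∀ c ∈ L, h' c ∈ B ↔ c ∈ B' := fun c hc => by
    rw [← hhB _ (hh.mapsTo_right hc), hh.right_inv c hc]
  have hLB : IsClosed (L ∩ B') := hh.closed_right.inter hB'.isClosed
  have hh'c : ContinuousOn h' (L ∩ B') := hh.cont_right.mono inter_subset_left
  have hE₁ : IsClosed (L ∩ B' ∩ (τ ∘ h') ⁻¹' K) :=
    (τ.continuous.comp_continuousOn hh'c).preimage_isClosed_of_isClosed hLB hh.closed_left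
  have hE₀ : IsClosed (L ∩ B' ∩ h' ⁻¹' {b | b ∈ K ∧ τ b ∉ K}) :=
    hh'c.preimage_isClosed_of_isClosed hLB
      (hh.inter_left.isClosed_escape hh.closed_left hτ)
  have hdiff : μ '' (L ∩ B') \ μ '' (L ∩ B' ∩ (τ ∘ h') ⁻¹' K) =
      μ '' (L ∩ B' ∩ h' ⁻¹' {b | b ∈ K ∧ τ b ∉ K}) := by
    rw [← image_sdiff μ.injective]
    congr 1
    ext c
    constructor
    · rintro ⟨hc, hc'⟩
      exact ⟨hc, hh.mapsTo_right hc.1, fun h => hc' ⟨hc, h⟩⟩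
    · rintro ⟨hc, hc'⟩
      exact ⟨hc, fun h => hc'.2 h.2⟩
  obtain ⟨α, hα, hαA, hαs, hα0⟩ := exists_mem_extend hΛ hmin (A := A') (E := μ '' (L ∩ B'))
    (F := L ∩ A') (E₁ := μ '' (L ∩ B' ∩ (τ ∘ h') ⁻¹' K)) (s := fun z => h (τ (h' (μ.symm z))))
    hA' (μ.isClosed_image.2 hLB) (hh.closed_right.inter hA'.isClosed)
    ((hh.thin_right.mono inter_subset_left).image hLB hμ)
    (hh.thin_right.mono inter_subset_left)
    (by
      rintro _ ⟨c, hc, rfl⟩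
      exact (hμA c).2 hc.2)
    inter_subset_right (image_mono inter_subset_left) (μ.isClosed_image.2 hE₁)
    (hdiff ▸ μ.isClosed_image.2 hE₀)
    (by
      rintro _ ⟨c, ⟨hc, hcτ⟩, rfl⟩
      obtain ⟨l, hl, hev⟩ := hh.inter_left τ hτ (h' c) (hh.mapsTo_right hc.1) hcτ
      refine ⟨l * μ⁻¹, Λ.mul_mem hl (Λ.inv_mem hμ), ?_⟩
      have ht : Tendsto (fun z => h' (μ.symm z)) (𝓝[μ '' (L ∩ B' ∩ (τ ∘ h') ⁻¹' K)] (μ c))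
          (𝓝[K] (h' c)) := by
        have h1 : Tendsto μ.symm (𝓝[μ '' (L ∩ B' ∩ (τ ∘ h') ⁻¹' K)] (μ c)) (𝓝[L] c) := by
          refine tendsto_nhdsWithin_iff.2 ⟨?_, ?_⟩
          · have := μ.symm.continuous.tendsto (μ c)
            rw [μ.symm_apply_apply] at this
            exact this.mono_left nhdsWithin_le_nhds
          · filter_upwards [self_mem_nhdsWithin] with z hz
            obtain ⟨w, hw, rfl⟩ := hz
            simpa using hw.1.1
        exact (tendsto_nhdsWithin_iff.2 ⟨hh.cont_right c hc.1,
          mem_of_superset self_mem_nhdsWithin hh.mapsTo_right⟩).comp h1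
      filter_upwards [ht.eventually hev, self_mem_nhdsWithin] with z hz hzE
      obtain ⟨w, hw, rfl⟩ := hzE
      rw [hz.2, μ.symm_apply_apply, hh.right_inv w hw.1.1, Homeomorph.mul_apply,
        Homeomorph.inv_apply, μ.symm_apply_apply])
    (by
      rintro _ ⟨c, hc, rfl⟩ _ ⟨d, hd, rfl⟩ hcd
      simp only [Homeomorph.symm_apply_apply] at hcd
      have h1 := congrArg h' hcd
      rw [hh.left_inv (τ (h' c)) hc.2, hh.left_inv (τ (h' d)) hd.2] at h1
      have h2 := congrArg h (τ.injective h1)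
      rw [hh.right_inv _ hc.1.1, hh.right_inv _ hd.1.1] at h2
      rw [h2])
    (by
      rintro _ ⟨c, hc, rfl⟩
      simp only [Homeomorph.symm_apply_apply]
      exact ⟨hh.mapsTo_left hc.2, (hhA _ hc.2).2 ((hτBA _).2 ((hhB' c hc.1.1).2 hc.1.2))⟩)
  refine ⟨α * μ, Λ.mul_mem hα hμ, fun c => ?_, fun b hbK hbB => ⟨fun hτb => ?_, fun hτb => ?_⟩⟩
  · rw [Homeomorph.mul_apply, hαA, hμA]
  · have hmem : h b ∈ L ∩ B' ∩ (τ ∘ h') ⁻¹' K := by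
      refine ⟨⟨hh.mapsTo_left hbK, (hhB b hbK).2 hbB⟩, ?_⟩
      rw [mem_preimage, Function.comp_apply, hh.left_inv b hbK]
      exact hτb
    rw [Homeomorph.mul_apply, hαs (mem_image_of_mem μ hmem)]
    simp only [Homeomorph.symm_apply_apply]
    rw [hh.left_inv b hbK]
  · have hmem : h b ∈ L ∩ B' ∩ h' ⁻¹' {b | b ∈ K ∧ τ b ∉ K} := by
      refine ⟨⟨hh.mapsTo_left hbK, (hhB b hbK).2 hbB⟩, ?_⟩
      rw [mem_preimage, hh.left_inv b hbK]
      exact ⟨hbK, hτb⟩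
    intro hL
    refine hα0 (μ (h b)) (hdiff ▸ mem_image_of_mem μ hmem) ⟨hL, ?_⟩
    rw [hαA, hμA]
    exact hmem.1.2

open Classical in
/-- If `τ ∈ Γ` maps the base cell of `b₁` onto a different base cell, that of `b₀`, the towers over
these cells can be merged by `τ` on the first side and, simultaneously, by an element of `Λ` on the
second side. -/
theorem IsMatching.exists_merge (hΓ : IsAmple Γ) (hΛ : IsAmple Λ) (hmin : IsMinimal Λ)
    {φ : X ≃ₜ X}
    (hφ : ∀ A B : Set X, IsClopen A → IsClopen B →
      (EquiDec Γ A B ↔ EquiDec Λ (φ '' A) (φ '' B)))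
    {K L : Set X} {h h' : X → X} (hh : IsPartialConj Γ Λ K L h h') {S : Stage X}
    (H : IsMatching Γ Λ φ K h S) {b₀ b₁ : X} (hb₀ : S.θ b₀ = b₀) (hb₁ : S.θ b₁ = b₁)
    (hb : S.q b₁ ≠ S.q b₀) {τ : X ≃ₜ X} (hτ : τ ∈ Γ)
    (hτb : ∀ b, S.q (τ b) = S.q b₀ ↔ S.q b = S.q b₁) :
    ∃ T : Stage X, IsMatching Γ Λ φ K h T ∧ Extends S T ∧ T.q = S.q ∧
      T.θ = fun x => if S.q (S.θ x) = S.q b₁ then τ (S.θ x) else S.θ x := by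
  obtain ⟨k, k', hkk, hk, hk'⟩ := H.descend hΓ hΛ hh
  have hcell := H.cell_descend hk
  have hequi : EquiDec Λ {c | S.r c = S.q b₁} {c | S.r c = S.q b₀} := by
    have h0 := H.equi b₀
    have h1 := H.equi b₁
    rw [hb₀] at h0
    rw [hb₁] at h1
    refine h1.symm.trans (EquiDec.trans ((hφ _ _ (H.left.locConst.isClopen_fiber _)
      (H.left.locConst.isClopen_fiber _)).1 ⟨τ, hτ, ?_⟩) h0)
    ext z
    constructor
    · rintro ⟨b, hb, rfl⟩
      exact (hτb b).2 hb
    · intro hz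
      refine ⟨τ.symm z, ?_, τ.apply_symm_apply z⟩
      change S.q _ = _
      rw [← hτb, τ.apply_symm_apply]
      exact hz
  obtain ⟨l, hl, hlb, hlK⟩ := hkk.exists_matching_element hΛ hmin
    (A := {b | S.q b = S.q b₀}) (B := {b | S.q b = S.q b₁})
    (H.right.locConst.isClopen_fiber _) (H.right.locConst.isClopen_fiber _)
    (fun x hx => by
      change S.r _ = _ ↔ S.q _ = _
      rw [hcell x hx])
    (fun x hx => by
      change S.r _ = _ ↔ S.q _ = _
      rw [hcell x hx]) hequi hτ hτb
  obtain ⟨y₀, hy₀⟩ := H.total_left b₀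
  have hηy₀ := H.cross b₀ y₀ hy₀
  rw [hb₀] at hηy₀
  have hleft := H.left.merge hb (fun b hb' => H.left.fixed (hb'.trans (congrArg S.q hb₀.symm)))
    hτ hτb
  have hright := H.right.merge hb (fun b hb' => H.right.fixed (hb'.trans hηy₀)) hl hlb
  have hrK : ∀ x ∈ K, S.r (S.η (h x)) = S.q (S.θ x) := fun x hx =>
    (H.cross _ _ (H.cell x hx).symm).symm
  have hmix : ∀ x ∈ K, ∀ x' ∈ K, S.q (S.θ x) = S.q b₁ →
      (τ (S.θ x) = S.θ x' ↔ l (S.η (h x)) = S.η (h x')) := by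
    intro x hx x' hx' hxj
    obtain ⟨h1, h2⟩ := hlK (S.θ x) (mem_image_of_mem _ hx) hxj
    rw [hk x hx] at h1 h2
    constructor
    · intro e
      rw [h1 (e ▸ mem_image_of_mem _ hx'), e, hk x' hx']
    · intro e
      have hmem : τ (S.θ x) ∈ S.θ '' K := by
        by_contra hcon
        exact h2 hcon (e ▸ mem_image_of_mem _ (hh.mapsTo_left hx'))
      have h3 := h1 hmem
      rw [e, ← hk x' hx'] at h3
      have h4 := congrArg k' h3
      rw [hkk.left_inv _ (mem_image_of_mem _ hx'), hkk.left_inv _ hmem] at h4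
      exact h4.symm
  have hcross : ∀ x y, S.q x = S.r y →
      S.q (if S.q (S.θ x) = S.q b₁ then τ (S.θ x) else S.θ x) =
        S.r (if S.r (S.η y) = S.q b₁ then l (S.η y) else S.η y) := by
    intro x y hxy
    have h1 := H.cross x y hxy
    by_cases hx : S.q (S.θ x) = S.q b₁
    · rw [if_pos hx, if_pos (h1.symm.trans hx), (hτb _).2 hx]
      exact ((hlb _).2 (h1.symm.trans hx)).symm
    · rw [if_neg hx, if_neg fun h => hx (h1.trans h), h1]
  refine ⟨⟨S.q, fun x => if S.q (S.θ x) = S.q b₁ then τ (S.θ x) else S.θ x, S.r,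
    fun y => if S.r (S.η y) = S.q b₁ then l (S.η y) else S.η y⟩,
    ⟨hleft, hright, H.total_left, H.total_right, hcross, ?_, H.cell, ?_⟩,
    ⟨fun _ _ h => h, H.cross, fun _ _ h _ => h, ?_, ?_⟩, rfl, rfl⟩
  · intro x
    by_cases hx : S.q (S.θ x) = S.q b₁
    · simp only [if_pos hx]
      rw [(hτb _).2 hx]
      have := H.equi b₀
      rwa [hb₀] at this
    · simp only [if_neg hx]
      exact H.equi x
  · intro x hx x' hx'
    simp only [hrK x hx, hrK x' hx']
    by_cases h1 : S.q (S.θ x) = S.q b₁ <;> by_cases h2 : S.q (S.θ x') = S.q b₁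
    · simp only [if_pos h1, if_pos h2, τ.injective.eq_iff, l.injective.eq_iff]
      exact H.fib x hx x' hx'
    · simp only [if_pos h1, if_neg h2]
      exact hmix x hx x' hx' h1
    · simp only [if_neg h1, if_pos h2]
      rw [eq_comm, hmix x' hx' x hx h2, eq_comm]
    · simp only [if_neg h1, if_neg h2]
      exact H.fib x hx x' hx'
  · intro x
    simp only [H.left.idem]
  · intro y
    simp only [H.right.idem]

end Merge

/-! ### Absorbing a group element into a matching -/

section Step

variable {X : Type*} [TopologicalSpace X] {Γ Λ : Subgroup (X ≃ₜ X)}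

theorem isLocallyConstant_pi {ι D : Type*} [Finite ι] {f : ι → X → D}
    (hf : ∀ i, IsLocallyConstant (f i)) : IsLocallyConstant fun x i => f i x := by
  rw [IsLocallyConstant.iff_eventually_eq]
  intro x
  filter_upwards [eventually_all.2 fun i => (hf i).eventually_eq x] with y hy
  exact funext hy

theorem IsFolding.exists_branches {q : X → ℕ} {θ : X → X} (hθ : IsFolding Γ q θ) :
    ∃ δ : ℕ → (X ≃ₜ X), (∀ i, δ i ∈ Γ) ∧ ∀ x, θ x = δ (q x) x := by
  have H : ∀ i, ∃ γ ∈ Γ, ∀ y, q y = i → θ y = γ y := by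
    intro i
    by_cases hi : ∃ x, q x = i
    · obtain ⟨x, rfl⟩ := hi
      exact hθ.exists_mem x
    · exact ⟨1, Γ.one_mem, fun y hy => absurd ⟨y, hy⟩ hi⟩
  choose δ hδ h using H
  exact ⟨δ, hδ, fun x => h _ x rfl⟩

variable [CompactSpace X] [T2Space X] [TotallyDisconnectedSpace X]

/-- Since its fixed-point set is open, an element of an ample group moves all points that it does
not fix to a different cell of a suitable partition. -/
theorem IsAmple.exists_separating (hΓ : IsAmple Γ) {g : X ≃ₜ X} (hg : g ∈ Γ) :
    ∃ r : X → ℕ, IsLocallyConstant r ∧ ∀ x, g x ≠ x → r (g x) ≠ r x := by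
  classical
  have hE : IsCompact {x | g x ≠ x} := (hΓ.isClopen_fixed g hg).compl.isClosed.isCompact
  suffices H : ∃ r : X → ℕ, IsLocallyConstant r ∧ ∀ x ∈ {x | g x ≠ x}, r (g x) ≠ r x from H
  refine hE.induction_on
    (p := fun T => ∃ r : X → ℕ, IsLocallyConstant r ∧ ∀ x ∈ T, r (g x) ≠ r x)
    ⟨fun _ => 0, IsLocallyConstant.const 0, by simp⟩ ?_ ?_ ?_
  · rintro T T' hT ⟨r, hr, h⟩
    exact ⟨r, hr, fun x hx => h x (hT hx)⟩
  · rintro T T' ⟨r, hr, h⟩ ⟨r', hr', h'⟩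
    refine ⟨fun x => Nat.pair (r x) (r' x), hr.comp₂ hr' Nat.pair, ?_⟩
    rintro x (hx | hx) e
    · exact h x hx (Nat.pair_eq_pair.1 e).1
    · exact h' x hx (Nat.pair_eq_pair.1 e).2
  · intro x hx
    obtain ⟨O₁, O₂, hO₁, hO₂, h1, h2, hd⟩ := t2_separation (show g x ≠ x from hx)
    obtain ⟨W, hW, hxW, hWsub⟩ := compact_exists_isClopen_in_isOpen
      ((hO₁.preimage g.continuous).inter hO₂) ⟨h1, h2⟩
    refine ⟨W, mem_nhdsWithin_of_mem_nhds (hW.isOpen.mem_nhds hxW),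
      fun x => if x ∈ W then 1 else 0, ?_, ?_⟩
    · rw [IsLocallyConstant.iff_eventually_eq]
      intro y
      by_cases hy : y ∈ W
      · filter_upwards [hW.isOpen.mem_nhds hy] with z hz
        rw [if_pos hz, if_pos hy]
      · filter_upwards [hW.compl.isOpen.mem_nhds hy] with z hz
        rw [if_neg hz, if_neg hy]
    · intro y hy
      have : g y ∉ W := fun h => disjoint_left.1 hd (hWsub hy).1 (hWsub h).2
      simp [hy, this]

/-- Every partition has a refinement on whose cells a given finite subgroup `G` of an ample group
acts by permutations, in such a way that an element of `G` preserving a cell fixes it pointwise. -/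
theorem IsAmple.exists_adapted (hΓ : IsAmple Γ) {G : Subgroup (X ≃ₜ X)} (hG : G ≤ Γ) [Finite G]
    {p₀ : X → ℕ} (hp₀ : IsLocallyConstant p₀) :
    ∃ p : X → ℕ, IsLocallyConstant p ∧ (∀ x x', p x = p x' → p₀ x = p₀ x') ∧
      (∀ g ∈ G, ∀ x x', p x = p x' → p (g x) = p (g x')) ∧
      ∀ g ∈ G, ∀ x, p (g x) = p x → g x = x := by
  have H : ∀ g : G, ∃ r : X → ℕ, IsLocallyConstant r ∧ ∀ x, g.1 x ≠ x → r (g.1 x) ≠ r x :=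
    fun g => hΓ.exists_separating (hG g.2)
  choose r hr hsep using H
  -- recording the colours along the whole `G`-orbit of `x` makes the partition `G`-invariant
  let P : X → G → ℕ × (G → ℕ) := fun x g => (p₀ (g.1 x), fun k => r k (g.1 x))
  have hP : IsLocallyConstant P := by
    refine isLocallyConstant_pi (f := fun (g : G) x => (p₀ (g.1 x), fun k => r k (g.1 x)))
      fun g => IsLocallyConstant.prodMk (hp₀.comp_continuous g.1.continuous) ?_
    exact isLocallyConstant_pi (f := fun (k : G) x => r k (g.1 x))
      fun k => (hr k).comp_continuous g.1.continuous
  obtain ⟨c, hc⟩ := exists_injective_nat (G → ℕ × (G → ℕ))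
  refine ⟨c ∘ P, hP.comp c, ?_, ?_, ?_⟩
  · intro x x' h
    exact congrArg Prod.fst (congrFun (hc h) 1)
  · intro g hg x x' h
    refine congrArg c (funext fun k => ?_)
    exact congrFun (hc h) (k * ⟨g, hg⟩)
  · intro g hg x h
    by_contra hne
    refine hsep ⟨g, hg⟩ x hne ?_
    exact congrFun (congrArg Prod.snd (congrFun (hc h) 1)) ⟨g, hg⟩

variable [TopologicalSpace.MetrizableSpace X] [PerfectSpace X] [MeasurableSpace X] [BorelSpace X]

/-- A matching extends to one whose cells refine a given partition and whose folding is invariant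
under a given element `γ` of `Γ`. First the base is refined so that a finite group `G` containing
`γ` and the branches of the folding permutes the cells; then base cells in the same `G`-orbit are
merged until no two are left. -/
theorem IsMatching.exists_step (hΓ : IsAmple Γ) (hΛ : IsAmple Λ) (hmin : IsMinimal Λ)
    {φ : X ≃ₜ X}
    (hφ : ∀ A B : Set X, IsClopen A → IsClopen B →
      (EquiDec Γ A B ↔ EquiDec Λ (φ '' A) (φ '' B)))
    {K L : Set X} {h h' : X → X} (hh : IsPartialConj Γ Λ K L h h') {S : Stage X}
    (H : IsMatching Γ Λ φ K h S) {γ : X ≃ₜ X} (hγ : γ ∈ Γ) {p₀ : X → ℕ}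
    (hp₀ : IsLocallyConstant p₀) :
    ∃ T : Stage X, IsMatching Γ Λ φ K h T ∧ Extends S T ∧
      (∀ x x', T.q x = T.q x' → p₀ x = p₀ x') ∧ ∀ x, T.θ (γ x) = T.θ x := by
  classical
  obtain ⟨δ, hδ, hδθ⟩ := H.left.exists_branches
  have hGsub : Subgroup.closure (insert γ (δ '' range S.q)) ≤ Γ := by
    rw [Subgroup.closure_le]
    rintro _ (rfl | ⟨i, -, rfl⟩)
    · exact hγ
    · exact hδ i
  have hγG : γ ∈ Subgroup.closure (insert γ (δ '' range S.q)) :=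
    Subgroup.subset_closure (mem_insert _ _)
  have hδG : ∀ x, δ (S.q x) ∈ Subgroup.closure (insert γ (δ '' range S.q)) := fun x =>
    Subgroup.subset_closure (mem_insert_of_mem _ (mem_image_of_mem δ (mem_range_self x)))
  have hGfin := hΓ.locallyFinite _ hGsub ((Subgroup.fg_iff _).2
    ⟨_, rfl, (H.left.locConst.range_finite.image δ).insert γ⟩)
  generalize Subgroup.closure (insert γ (δ '' range S.q)) = G at hGsub hγG hδG hGfin
  obtain ⟨p, hp, hpp₀, hpG, hpfix⟩ := hΓ.exists_adapted hGsub
    (hp₀.comp₂ H.left.locConst Nat.pair)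
  obtain ⟨S₁, hS₁, hSS₁, hq₁, hθ₁⟩ := H.exists_refine hΓ hΛ hmin hh hp
  -- the cells of the refined matching are exactly the cells of `p`
  have hq₁p : ∀ x x', S₁.q x = S₁.q x' ↔ p x = p x' := by
    intro x x'
    simp only [hq₁, Nat.pair_eq_pair]
    constructor
    · rintro ⟨h1, h2⟩
      have h3 := hpG _ (G.inv_mem (hδG x)) _ _ h2
      rw [hδθ x, hδθ x', ← h1] at h3
      simpa only [Homeomorph.inv_apply, Homeomorph.symm_apply_apply] using h3
    · intro h1
      have h2 : S.q x = S.q x' := (Nat.pair_eq_pair.1 (hpp₀ x x' h1)).2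
      refine ⟨h2, ?_⟩
      rw [hδθ x, hδθ x', ← h2]
      exact hpG _ (hδG x) _ _ h1
  let base : Stage X → Set ℕ := fun T => {i | ∃ b, T.θ b = b ∧ T.q b = i}
  let Q : Set (Stage X) := {T | IsMatching Γ Λ φ K h T ∧ Extends S T ∧ T.q = S₁.q ∧
    ∀ x, ∃ g ∈ G, T.θ x = g x}
  have hS₁Q : S₁ ∈ Q := ⟨hS₁, hSS₁, rfl, fun x => ⟨_, hδG x, by rw [hθ₁, hδθ]⟩⟩
  obtain ⟨T, ⟨hT, hST, hTq, hTG⟩, hTmin⟩ : ∃ T ∈ Q, ∀ T' ∈ Q, (base T).ncard ≤ (base T').ncard := by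
    obtain ⟨T, hT, e⟩ := Nat.sInf_mem (s := (fun T => (base T).ncard) '' Q) ⟨_, S₁, hS₁Q, rfl⟩
    exact ⟨T, hT, fun T' hT' => by
      simp only at e
      rw [e]
      exact Nat.sInf_le ⟨T', hT', rfl⟩⟩
  -- by minimality, no two base cells are in the same `G`-orbit
  have hclaim : ∀ b, T.θ b = b → ∀ g ∈ G, T.θ (g b) = g b → g b = b := by
    intro b hb g hg hgb
    by_contra hne
    have hq : T.q (g b) ≠ T.q b := fun e => hne (hpfix g hg b (by rwa [hTq, hq₁p] at e))
    have hτb : ∀ c, T.q ((g⁻¹ : X ≃ₜ X) c) = T.q b ↔ T.q c = T.q (g b) := by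
      intro c
      rw [hTq, hq₁p, hq₁p]
      constructor
      · intro e
        have := hpG g hg _ _ e
        rwa [Homeomorph.inv_apply, g.apply_symm_apply] at this
      · intro e
        have := hpG _ (G.inv_mem hg) _ _ e
        rwa [show (g⁻¹ : X ≃ₜ X) (g b) = b from g.symm_apply_apply b] at this
    obtain ⟨T', hT', hTT', hTq', hTθ'⟩ := hT.exists_merge hΓ hΛ hmin hφ hh hb hgb hq
      (Γ.inv_mem (hGsub hg)) hτb
    have hT'Q : T' ∈ Q := by
      refine ⟨hT', hST.trans hTT', hTq'.trans hTq, fun x => ?_⟩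
      obtain ⟨k, hk, hkx⟩ := hTG x
      rw [hTθ']
      simp only
      split_ifs
      · exact ⟨g⁻¹ * k, G.mul_mem (G.inv_mem hg) hk, by rw [hkx, Homeomorph.mul_apply]⟩
      · exact ⟨k, hk, hkx⟩
    have hlt : base T' ⊂ base T := by
      have hsub : ∀ c, T'.θ c = c → T.θ c = c ∧ T.q c ≠ T.q (g b) := by
        intro c hc
        rw [hTθ'] at hc
        simp only at hc
        split_ifs at hc with hcj
        · have h1 : T.q c = T.q b := by
            conv_lhs => rw [← hc]
            exact (hτb _).2 hcj
          have h2 : T.θ c = c := hT.left.fixed (x := b) (h1.trans (congrArg T.q hb.symm))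
          exact absurd (hcj.symm.trans ((congrArg T.q h2).trans h1)) hq
        · exact ⟨hc, fun e => hcj (by rwa [hc])⟩
      refine ⟨?_, fun hcon => ?_⟩
      · rintro _ ⟨c, hc, rfl⟩
        exact ⟨c, (hsub c hc).1, by rw [hTq']⟩
      · obtain ⟨c, hc, hcq⟩ := hcon ⟨g b, hgb, rfl⟩
        exact (hsub c hc).2 (by rw [← hcq, hTq'])
    have hfin : (base T).Finite := hT.left.locConst.range_finite.subset (by
      rintro _ ⟨c, -, rfl⟩
      exact mem_range_self c)
    exact absurd (hTmin T' hT'Q) (not_le.2 (ncard_lt_ncard hlt hfin))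
  refine ⟨T, hT, hST, fun x x' e => ?_, fun x => ?_⟩
  · rw [hTq, hq₁p] at e
    exact (Nat.pair_eq_pair.1 (hpp₀ x x' e)).1
  · obtain ⟨g, hg, hgx⟩ := hTG x
    obtain ⟨k, hk, hkx⟩ := hTG (γ x)
    have h1 : (k * γ * g⁻¹ : X ≃ₜ X) (T.θ x) = T.θ (γ x) := by
      rw [hgx, hkx]
      simp only [Homeomorph.mul_apply, Homeomorph.inv_apply, Homeomorph.symm_apply_apply]
    rw [← h1]
    refine hclaim _ (hT.left.idem x) _ (G.mul_mem (G.mul_mem hk hγG) (G.inv_mem hg)) ?_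
    rw [h1]
    exact hT.left.idem _

end Step

/-! ### Passing to the limit -/

section Limit

variable {X : Type*} [TopologicalSpace X] {Γ Λ : Subgroup (X ≃ₜ X)}

theorem Extends.refines_left {φ : X ≃ₜ X} {K : Set X} {h : X → X} {S T : Stage X}
    (H : Extends S T) (hT : IsMatching Γ Λ φ K h T) {x x' : X} (e : T.q x = T.q x') :
    S.q x = S.q x' := by
  obtain ⟨y, hy⟩ := hT.total_left x
  rw [H.refines x y hy, H.refines x' y (e.symm.trans hy)]

theorem isFolding_trivial : IsFolding Γ (fun _ => 0) (id : X → X) where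
  locConst := IsLocallyConstant.const 0
  idem _ := rfl
  exists_mem _ := ⟨1, Γ.one_mem, fun _ _ => rfl⟩
  cell_map _ _ _ := rfl
  onto _ b _ := ⟨b, rfl, rfl⟩

theorem isMatching_trivial {φ : X ≃ₜ X} {K : Set X} {h : X → X} (hinj : InjOn h K) :
    IsMatching Γ Λ φ K h ⟨fun _ => 0, id, fun _ => 0, id⟩ where
  left := isFolding_trivial
  right := isFolding_trivial
  total_left x := ⟨x, rfl⟩
  total_right y := ⟨y, rfl⟩
  cross _ _ _ := rfl
  equi _ := ⟨1, Λ.one_mem, by simp [φ.surjective.range_eq]⟩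
  cell _ _ := rfl
  fib _ hx _ hx' := (hinj.eq_iff hx hx').symm

/-- A homeomorphism that carries a folding along `Γ`, invariant under `γ`, to a folding along `Λ`
conjugates `γ` to an element of `Λ`: locally, `γ` is a composition of branches of the folding. -/
theorem IsFolding.conj_mem [CompactSpace X] [T2Space X] [TotallyDisconnectedSpace X]
    (hΛ : IsFull Λ) {q r : X → ℕ} {θ η : X → X} (hq : IsLocallyConstant q)
    (hη : IsFolding Λ r η) {H : X ≃ₜ X} (hHq : ∀ x, r (H x) = q x)
    (hHθ : ∀ x, H (θ x) = η (H x)) {γ : X ≃ₜ X} (hγ : ∀ x, θ (γ x) = θ x) :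
    (H.symm.trans γ).trans H ∈ Λ := by
  refine hΛ.mem_of_locallyIn fun y => ?_
  obtain ⟨l₁, hl₁, h₁⟩ := hη.exists_mem y
  obtain ⟨l₂, hl₂, h₂⟩ := hη.exists_mem (H (γ (H.symm y)))
  refine ⟨l₂⁻¹ * l₁, Λ.mul_mem (Λ.inv_mem hl₂) hl₁, ?_⟩
  have e1 := (H.symm.continuous.tendsto y).eventually (hq.eventually_eq (H.symm y))
  have e2 := ((γ.continuous.comp H.symm.continuous).tendsto y).eventually
    (hq.eventually_eq (γ (H.symm y)))
  filter_upwards [e1, e2] with z hz1 hz2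
  have h3 : η (H (γ (H.symm z))) = η z := by
    rw [← hHθ, hγ, hHθ, H.apply_symm_apply]
  rw [h₁ z (by rw [← H.apply_symm_apply z, ← H.apply_symm_apply y, hHq, hHq, hz1]),
    h₂ (H (γ (H.symm z))) (by rw [hHq, hHq]; exact hz2)] at h3
  rw [Homeomorph.mul_apply, Homeomorph.inv_apply, ← h3, l₂.symm_apply_apply]
  rfl

variable [CompactSpace X]

/-- Two sequences of partitions that separate points and have the same combinatorics are exchanged
by a unique homeomorphism. -/
theorem exists_limit {q r : ℕ → X → ℕ} (hq : ∀ n, IsLocallyConstant (q n))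
    (hr : ∀ n, IsLocallyConstant (r n)) (hqsep : ∀ x x', (∀ n, q n x = q n x') → x = x')
    (hrsep : ∀ y y', (∀ n, r n y = r n y') → y = y') (hqr : ∀ n x, ∃ y, q n x = r n y)
    (hrq : ∀ n y, ∃ x, q n x = r n y)
    (hmono : ∀ n x y, q (n + 1) x = r (n + 1) y → q n x = r n y) :
    ∃ H : X ≃ₜ X, ∀ x y, (∀ n, q n x = r n y) ↔ H x = y := by
  have hex : ∀ x, ∃ y, ∀ n, q n x = r n y := by
    intro x
    obtain ⟨y, hy⟩ := IsCompact.nonempty_iInter_of_sequence_nonempty_isCompact_isClosed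
      (fun n => {y | q n x = r n y}) (fun n y => hmono n x y) (fun n => hqr n x)
      (by simpa only [eq_comm] using ((hr 0).isClosed_fiber (q 0 x)).isCompact)
      (fun n => by simpa only [eq_comm] using (hr n).isClosed_fiber (q n x))
    exact ⟨y, fun n => mem_iInter.1 hy n⟩
  have hex' : ∀ y, ∃ x, ∀ n, q n x = r n y := by
    intro y
    obtain ⟨x, hx⟩ := IsCompact.nonempty_iInter_of_sequence_nonempty_isCompact_isClosed
      (fun n => {x | q n x = r n y}) (fun n x => hmono n x y) (fun n => hrq n y)
      ((hq 0).isClosed_fiber (r 0 y)).isCompact (fun n => (hq n).isClosed_fiber (r n y))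
    exact ⟨x, fun n => mem_iInter.1 hx n⟩
  choose f hf using hex
  choose g hg using hex'
  -- the cell codes `b` embed `X` into `ℕ → ℕ`, and `k` becomes the continuous map `a` there
  have hcont : ∀ {a b : ℕ → X → ℕ} {k : X → X}, (∀ n, IsLocallyConstant (a n)) →
      (∀ n, IsLocallyConstant (b n)) → (∀ y y', (∀ n, b n y = b n y') → y = y') →
      (∀ x n, a n x = b n (k x)) → Continuous k := by
    intro a b k ha hb hsep hk
    have hemb : IsClosedEmbedding fun y n => b n y :=
      (continuous_pi fun n => (hb n).continuous).isClosedEmbedding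
        fun y y' h => hsep y y' fun n => congrFun h n
    rw [hemb.isInducing.continuous_iff]
    have : ((fun y n => b n y) ∘ k) = fun x n => a n x := by
      funext x n
      exact (hk x n).symm
    rw [this]
    exact continuous_pi fun n => (ha n).continuous
  refine ⟨⟨⟨f, g, fun x => hqsep _ _ fun n => ?_, fun y => hrsep _ _ fun n => ?_⟩,
    hcont hq hr hrsep hf, hcont hr hq hqsep fun y n => (hg y n).symm⟩, fun x y => ⟨fun h => ?_, ?_⟩⟩
  · rw [hg, hf]
  · rw [← hf, hg]
  · exact hrsep _ _ fun n => (hf x n).symm.trans (h n)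
  · rintro rfl n
    exact hf x n

variable [T2Space X] [TotallyDisconnectedSpace X]
  [TopologicalSpace.MetrizableSpace X] [PerfectSpace X] [MeasurableSpace X] [BorelSpace X]

/-- The back-and-forth step: both sides of a matching absorb a group element and a partition. -/
theorem IsMatching.exists_back_and_forth (hΓ : IsAmple Γ) (hΓmin : IsMinimal Γ) (hΛ : IsAmple Λ)
    (hΛmin : IsMinimal Λ) {φ : X ≃ₜ X}
    (hφ : ∀ A B : Set X, IsClopen A → IsClopen B →
      (EquiDec Γ A B ↔ EquiDec Λ (φ '' A) (φ '' B)))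
    {K L : Set X} {h h' : X → X} (hh : IsPartialConj Γ Λ K L h h') {S : Stage X}
    (H : IsMatching Γ Λ φ K h S) {γ l : X ≃ₜ X} (hγ : γ ∈ Γ) (hl : l ∈ Λ) {p : X → ℕ}
    (hp : IsLocallyConstant p) :
    ∃ T : Stage X, IsMatching Γ Λ φ K h T ∧ Extends S T ∧
      (∀ x x', T.q x = T.q x' → p x = p x') ∧ (∀ x, T.θ (γ x) = T.θ x) ∧
      (∀ y y', T.r y = T.r y' → p y = p y') ∧ ∀ y, T.η (l y) = T.η y := by
  have hφ' : ∀ A B : Set X, IsClopen A → IsClopen B →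
      (EquiDec Λ A B ↔ EquiDec Γ (φ.symm '' A) (φ.symm '' B)) := by
    intro A B hA hB
    rw [hφ _ _ ⟨φ.symm.isClosed_image.2 hA.1, φ.symm.isOpen_image.2 hA.2⟩
      ⟨φ.symm.isClosed_image.2 hB.1, φ.symm.isOpen_image.2 hB.2⟩, image_image, image_image]
    simp
  obtain ⟨T, hT, hST, hTp, hTγ⟩ := H.exists_step hΓ hΛ hΛmin hφ hh hγ hp
  obtain ⟨U, hU, hTU, hUp, hUl⟩ := (hT.swap hφ hh).exists_step hΛ hΓ hΓmin hφ' hh.symm hl hp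
  have hU' := hU.swap hφ' hh.symm
  have hTU' := hTU.swap
  refine ⟨U.swap, hU', hST.trans hTU', fun x x' e => hTp x x' (hTU'.refines_left hU' e),
    fun x => ?_, hUp, hUl⟩
  have h1 := hTU'.fold_left
  change ∀ x, U.swap.θ (T.θ x) = U.swap.θ x at h1
  rw [← h1, hTγ, h1]

/-- Iterating the back-and-forth step along enumerations of both groups gives, in the limit, the
homeomorphism that extends `h` and conjugates `Γ` onto `Λ`. -/
theorem exists_conjugacy (hΓ : IsAmple Γ) (hΓmin : IsMinimal Γ) (hΛ : IsAmple Λ)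
    (hΛmin : IsMinimal Λ) (hiso : IsomorphicOnClopens Γ Λ)
    {K L : Set X} {h h' : X → X} (hh : IsPartialConj Γ Λ K L h h')
    {p : ℕ → X → ℕ} (hp : ∀ n, IsLocallyConstant (p n))
    (hpsep : ∀ x x', (∀ n, p n x = p n x') → x = x') :
    ∃ H : X ≃ₜ X, (∀ x ∈ K, H x = h x) ∧ conjugate H Γ = (Λ : Set (X ≃ₜ X)) := by
  obtain ⟨φ, hφ⟩ := hiso
  have := hΓ.countable
  have := hΛ.countable
  obtain ⟨a, ha⟩ := exists_surjective_nat Γ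
  obtain ⟨b, hb⟩ := exists_surjective_nat Λ
  have step : ∀ (n : ℕ) (S : {S : Stage X // IsMatching Γ Λ φ K h S}),
      ∃ T : {S : Stage X // IsMatching Γ Λ φ K h S}, Extends S.1 T.1 ∧
        (∀ x x', T.1.q x = T.1.q x' → p n x = p n x') ∧
        (∀ x, T.1.θ ((a n).1 x) = T.1.θ x) ∧
        (∀ y y', T.1.r y = T.1.r y' → p n y = p n y') ∧
        ∀ y, T.1.η ((b n).1 y) = T.1.η y := by
    intro n S
    obtain ⟨T, hT, h⟩ := S.2.exists_back_and_forth hΓ hΓmin hΛ hΛmin hφ hh (a n).2 (b n).2 (hp n)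
    exact ⟨⟨T, hT⟩, h⟩
  choose next hext hqp hθa hrp hηb using step
  have hinj : InjOn h K := fun x hx x' hx' e => by
    rw [← hh.left_inv x hx, e, hh.left_inv x' hx']
  let S : ℕ → {S : Stage X // IsMatching Γ Λ φ K h S} := fun n =>
    Nat.rec ⟨_, isMatching_trivial hinj⟩ next n
  have hS : ∀ n, S (n + 1) = next n (S n) := fun n => rfl
  have hle : ∀ n m, n ≤ m → Extends (S n).1 (S m).1 := by
    intro n m hnm
    induction m, hnm using Nat.le_induction with
    | base => exact (S n).2.extends_refl
    | succ m _ ih => exact ih.trans (hS m ▸ hext m (S m))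
  obtain ⟨H, hH⟩ := exists_limit (q := fun n => (S n).1.q) (r := fun n => (S n).1.r)
    (fun n => (S n).2.left.locConst) (fun n => (S n).2.right.locConst)
    (fun x x' e => hpsep x x' fun n => hqp n (S n) x x' (e (n + 1)))
    (fun y y' e => hpsep y y' fun n => hrp n (S n) y y' (e (n + 1)))
    (fun n => (S n).2.total_left) (fun n => (S n).2.total_right)
    (fun n => (hle n (n + 1) n.le_succ).refines)
  have hHcell : ∀ n x, (S n).1.q x = (S n).1.r (H x) := fun n x => (hH x (H x)).2 rfl n
  have hHθ : ∀ n x, H ((S n).1.θ x) = (S n).1.η (H x) := by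
    intro n x
    refine (hH _ _).1 fun m => ?_
    rcases le_total n m with hnm | hmn
    · exact (hle n m hnm).cross _ _ (hHcell m x)
    · exact (hle m n hmn).refines _ _ ((S n).2.cross _ _ (hHcell n x))
  refine ⟨H, fun x hx => (hH _ _).1 fun n => ((S n).2.cell x hx).symm, ?_⟩
  ext f
  constructor
  · rintro ⟨g, hg, rfl⟩
    obtain ⟨n, hn⟩ := ha ⟨g, hg⟩
    have hθ := hθa n (S n)
    rw [hn] at hθ
    exact (S (n + 1)).2.right.conj_mem hΛ.full (S (n + 1)).2.left.locConst
      (fun x => (hHcell (n + 1) x).symm) (hHθ (n + 1)) hθ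
  · intro hf
    obtain ⟨n, hn⟩ := hb ⟨f, hf⟩
    have hη := hηb n (S n)
    rw [hn] at hη
    refine ⟨(H.trans f).trans H.symm, ?_, ?_⟩
    · refine (S (n + 1)).2.left.conj_mem (H := H.symm) hΓ.full (S (n + 1)).2.right.locConst
        (fun y => ?_) (fun y => ?_) hη
      · rw [hHcell (n + 1), H.apply_symm_apply]
      · apply H.injective
        rw [hHθ (n + 1), H.apply_symm_apply, H.apply_symm_apply]
    · ext y
      simp

end Limit

/-! ### The Cantor space -/

instance perfectSpace_cantor : PerfectSpace (ℕ → Bool) := by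
  refine perfectSpace_iff_forall_not_isolated.2 fun x => ?_
  have ht : Tendsto (fun n => Function.update x n (!x n)) atTop (𝓝[≠] x) := by
    refine tendsto_nhdsWithin_iff.2 ⟨tendsto_pi_nhds.2 fun i => ?_, Eventually.of_forall ?_⟩
    · refine tendsto_const_nhds.congr' ?_
      filter_upwards [eventually_gt_atTop i] with n hn
      rw [Function.update_of_ne hn.ne]
    · intro n h
      have := congrFun h n
      simp at this
  exact ht.neBot

theorem perfectSpace_of_homeomorph {X Y : Type*} [TopologicalSpace X] [TopologicalSpace Y]
    [PerfectSpace Y] (e : X ≃ₜ Y) : PerfectSpace X := by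
  refine perfectSpace_iff_forall_not_isolated.2 fun x => ?_
  have ht : Tendsto e.symm (𝓝[≠] (e x)) (𝓝[≠] x) := by
    refine tendsto_nhdsWithin_iff.2 ⟨?_, ?_⟩
    · have := e.symm.continuous.tendsto (e x)
      rw [e.symm_apply_apply] at this
      exact this.mono_left nhdsWithin_le_nhds
    · filter_upwards [self_mem_nhdsWithin] with y hy h
      exact hy (by
        have h' : e.symm y = x := h
        rw [mem_singleton_iff, ← h', e.apply_symm_apply])
  exact ht.neBot

end CantorDynamics

end

open CantorDynamics in
theorem mainTheorem2 {X : Type*} [TopologicalSpace X] [MeasurableSpace X] [BorelSpace X]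
    (hX : Nonempty (X ≃ₜ (ℕ → Bool)))
    (Γ Λ : Subgroup (X ≃ₜ X))
    (hΓ : IsAmple Γ) (hΓmin : IsMinimal Γ)
    (hΛ : IsAmple Λ) (hΛmin : IsMinimal Λ)
    (hiso : IsomorphicOnClopens Γ Λ)
    (K L : Set X) (hK : IsMalleable Γ K) (hL : IsMalleable Λ L)
    (h : K ≃ₜ L)
    (hconj : conjugate h (inducedGroup Γ K) = (inducedGroup Λ L : Set (L ≃ₜ L))) :
    ∃ H : X ≃ₜ X, (∀ x : K, H (x : X) = (h x : X)) ∧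
      conjugate H Γ = (Λ : Set (X ≃ₜ X)) := by
  obtain ⟨e⟩ := hX
  have := e.symm.compactSpace
  have := e.isEmbedding.t2Space
  have : TotallyDisconnectedSpace X :=
    e.isEmbedding.isTotallyDisconnected_range.1 (isTotallyDisconnected_of_totallyDisconnectedSpace _)
  have := e.isEmbedding.metrizableSpace
  have := perfectSpace_of_homeomorph e
  obtain ⟨k, k', hk, hkk⟩ := exists_isPartialConj hΓ hΛ hK hL h hconj
  obtain ⟨H, hHK, hH⟩ := exists_conjugacy hΓ hΓmin hΛ hΛmin hiso hkk
    (p := fun n x => (e x n).toNat)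
    (fun n => (IsLocallyConstant.iff_continuous _).2 (by fun_prop))
    (fun x x' hxx' => e.injective (funext fun n => by
      have := hxx' n
      revert this
      cases e x n <;> cases e x' n <;> simp))
  exact ⟨H, fun x => (hHK x x.2).trans (hk x), hH⟩
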